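/- Let $k\ge 1$ and write $e(z)=e^{2\pi i z}$; $\mathbb H$ is the upper half plane and $\sqrt{\cdot}$ the principal branch. For $\lambda\ge 0$ let $S^k_\lambda\subset\mathbb R^k$ be the sphere of radius $\sqrt\lambda$ about $0$, $\delta_{S^k_\lambda}$ its surface measure ($\delta_{S^k_0}$ is the unit mass at $0$; for $k=1$, $\lambda>0$ it is the sum of the unit masses at $\pm\sqrt\lambda$), and $\operatorname{vol}(S^k_\lambda)$ its total mass (so $\operatorname{vol}(S^k_0)=1$). Let $\hat\varphi(y)=\int\varphi(x)e(-x^\top y)\,dx$ and $\langle\hat\mu,\varphi\rangle=\langle\mu,\hat\varphi\rangle$ for Schwartz functions $\varphi$ and tempered distributions $\mu$ on $\mathbb R^k$. *Admissible sequences.* Sequences $\lambda_m\in\mathbb R_{\ge0}$, $c_m\in\mathbb C$ ($m\ge 0$) are called admissible if $(\lambda_m)$ is locally finite (for every $R$ only finitely many $m$ have $\lambda_m\le R$) and the coefficients grow at most polynomially, in the sense that there are $C,N$ with $\sum_{\lambda_m\le R}|c_m|\le C(1+R)^N$ for all $R\ge0$. *The spaces.* $\operatorname{Meas}_k$ is the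 space of tempered distributions $\mu$ on $\mathbb R^k$ for which there are admissible $(\lambda_m,c_m)$ and $(\hat\lambda_m,\hat c_m)$ with $$\mu=\sum_m c_m\delta_{S^k_{\lambda_m}},\qquad \hat\mu=\sum_m\hat c_m\delta_{S^k_{\hat\lambda_m}}$$ (convergence in the space of tempered distributions). $\operatorname{FS}_k$ is the space of holomorphic $f:\mathbb H\to\mathbb C$ for which there are admissible $(\lambda_m,c_m)$ and $(\hat\lambda_m,\hat c_m)$ with $$f(\tau)=\sum_m c_m e\Bigl(\frac{\lambda_m\tau}{2}\Bigr),\qquad \tilde f(\tau):=\sqrt{-i\tau}^{\,-k}f(-1/\tau)=\sum_m\hat c_m e\Bigl(\frac{\hat\lambda_m\tau}{2}\Bigr)\qquad(\tau\in\mathbb H).$$ *The actions.* $\operatorname{Mp}_2(\mathbb R)$ is the group of pairs $(M,\phi)$ with $M=\begin{pmatrix}a&b\\c&d\end{pmatrix}\in\operatorname{SL}_2(\mathbb R)$ and $\phi:\mathbb H\to\mathbb C$ holomorphic, $\phi(\tau)^2=c\tau+d$, with product $(M_1,\phi_1)(M_2,\phi_2)=(M_1M_2,\phi_1(M_2\,\cdot)\phi_2)$.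 It acts on functions by $(f|_{k/2}(M,\phi))(\tau)=\phi(\tau)^{-k}f(M\tau)$ and on Schwartz functions on $\mathbb R^k$ by the Schrödinger model $\omega$ of the Weil representation, $$\omega(M,\phi)\varphi(x)=\phi^{k}\,e\bigl(-bd\,x^\top x/2\bigr)\,\varphi(dx)\quad(c=0,\text{ where }\phi\text{ is constant}),$$ $$\omega(M,\phi)\varphi(x)=\phi\bigl(-\tfrac dc+\tfrac i{c^2}\bigr)^{k}\,e\Bigl(-\frac{d\,x^\top x}{2c}\Bigr)\int_{\mathbb R^k}\varphi(y)\,e\Bigl(-\frac{a\,y^\top y}{2c}\Bigr)e\Bigl(\frac{x^\top y}{c}\Bigr)dy\quad(c\ne0).$$ Thus, for $\alpha>0$ and $\beta\in\mathbb R$, $\omega$ sends $\bigl(\begin{pmatrix}\alpha&0\\0&\alpha^{-1}\end{pmatrix},\alpha^{-1/2}\bigr)$ to $\varphi\mapsto\sqrt \alpha^{\,-k}\varphi(x/\alpha)$, $\bigl(\begin{pmatrix}1&\beta\\0&1\end{pmatrix},1\bigr)$ to $\varphi\mapsto e(-\beta\,x^\top x/2)\varphi(x)$, and $\bigl(\begin{pmatrix}0&-1\\1&0\end{pmatrix},\sqrt\tau\bigr)$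 to $\varphi\mapsto\sqrt i^{\,k}\hat\varphi(-x)$. For a tempered distribution $\mu$ put $\langle\mu|M,\varphi\rangle=\langle\mu,\omega(M^{-1})\varphi\rangle$ for $M\in\operatorname{Mp}_2(\mathbb R)$, and $$\theta_\mu(\tau)=\langle\mu,g(\cdot,\tau)\rangle,\qquad g(x,\tau)=e\bigl(x^\top x\,\tau/2\bigr).$$ **Theorem.** (1) The map $\mu\mapsto\theta_\mu$ is a linear isomorphism $\theta:\operatorname{Meas}_k\to\operatorname{FS}_k$. Its inverse sends $f\in\operatorname{FS}_k$ to $$\mu_f=\sum_m\frac{c_m}{\operatorname{vol}(S^k_{\lambda_m})}\,\delta_{S^k_{\lambda_m}}$$ for every expansion $f(\tau)=\sum_m c_m e(\lambda_m\tau/2)$ with admissible $(\lambda_m,c_m)$, the series converging in the space of tempered distributions. (2) $\theta$ is $\operatorname{Mp}_2(\mathbb R)$-equivariant: $\theta_{\mu|M}=\theta_\mu|_{k/2}M$ for all $M\in\operatorname{Mp}_2(\mathbb R)$ and all $\mu\in\operatorname{Meas}_k$ (indeed for all tempered distributions $\mu$ on $\mathbb R^k$). (3) For $\mu\in\operatorname{Meas}_k$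 one has $\hat\mu=\mu$ if and only if $\theta_\mu(-1/\tau)=\sqrt{-i\tau}^{\,k}\,\theta_\mu(\tau)$ for all $\tau\in\mathbb H$. -/

import Mathlib

open scoped SchwartzMap FourierTransform UpperHalfPlane MatrixGroups Manifold ContDiff

noncomputable section

namespace SphericalMeasure

/-! ## Euclidean space and surface measures of spheres -/

/-- Euclidean space `ℝ^k`. -/
abbrev Eucl (k : ℕ) : Type := EuclideanSpace ℝ (Fin k)

/-- The surface measure `δ_{S_lam^k}` of the sphere `S_lam^k` of radius `√lam` about the origin,
as a measure on `ℝ^k`: for `lam > 0` the image of the surface measure of the unit sphere under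
`x ↦ √lam x`, scaled by `√lam ^ (k - 1)`; for `lam = 0` the unit mass at the origin.
(For `k = 1` this is the sum of the two unit masses at `±√lam`.) -/
def surfaceMeasure (k : ℕ) (lam : ℝ) : MeasureTheory.Measure (Eucl k) :=
  if lam = 0 then MeasureTheory.Measure.dirac 0
  else ENNReal.ofReal (√lam ^ (k - 1)) •
    ((MeasureTheory.volume : MeasureTheory.Measure (Eucl k)).toSphere.map
      fun x : Metric.sphere (0 : Eucl k) 1 => √lam • (x : Eucl k))

instance (k : ℕ) (lam : ℝ) : MeasureTheory.IsFiniteMeasure (surfaceMeasure k lam) := by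
  unfold surfaceMeasure
  split_ifs
  · infer_instance
  · exact MeasureTheory.Measure.smul_finite _ ENNReal.ofReal_ne_top

/-- `vol(S_lam^k)`, the total mass of the surface measure (so `vol(S_0^k) = 1`). -/
def sphereVol (k : ℕ) (lam : ℝ) : ℝ := (surfaceMeasure k lam).real Set.univ

/-- The surface measure `δ_{S_lam^k}` as a tempered distribution. -/
def sphereDist (k : ℕ) (lam : ℝ) : 𝓢'(Eucl k, ℂ) := (surfaceMeasure k lam).toTemperedDistribution

/-! ## Locally finite sequences with coefficients of polynomial growth -/

/-- `lam` is a locally finite sequence of nonnegative reals, and the coefficients `c` attached to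
it grow at most polynomially: the total size of the coefficients with `lam m ≤ R` is bounded by a
polynomial in `R`. -/
structure IsAdmissible (lam : ℕ → ℝ) (c : ℕ → ℂ) : Prop where
  nonneg : ∀ m, 0 ≤ lam m
  locallyFinite : ∀ R : ℝ, {m | lam m ≤ R}.Finite
  polyGrowth : ∃ (C : ℝ) (N : ℕ), ∀ R : ℝ, 0 ≤ R → ∀ s : Finset ℕ, (∀ m ∈ s, lam m ≤ R) →
    ∑ m ∈ s, ‖c m‖ ≤ C * (1 + R) ^ N

/-- For a family `e lam` (`lam ≥ 0`) in a topological vector space, the subspace of all sums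
`∑ c_m e(lam_m)` of convergent series with `(lam_m, c_m)` admissible. -/
def seriesSpace {V : Type*} [AddCommGroup V] [Module ℂ V] [TopologicalSpace V] [ContinuousAdd V]
    [ContinuousConstSMul ℂ V] (e : ℝ → V) : Submodule ℂ V where
  carrier := {v | ∃ (lam : ℕ → ℝ) (c : ℕ → ℂ), IsAdmissible lam c ∧
    HasSum (fun m => c m • e (lam m)) v}
  zero_mem' := by
    refine ⟨fun m => m, fun _ => 0, ⟨fun m => Nat.cast_nonneg m, fun R => ?_, 0, 0, ?_⟩, ?_⟩
    · refine (Set.finite_Iic ⌊R⌋₊).subset fun m hm => ?_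
      exact Nat.le_floor hm
    · intro R _ s _
      simp
    · simp
  add_mem' := by
    rintro v w ⟨l₁, c₁, ⟨hn₁, hf₁, C₁, N₁, hp₁⟩, hs₁⟩ ⟨l₂, c₂, ⟨hn₂, hf₂, C₂, N₂, hp₂⟩, hs₂⟩
    let E : ℕ ⊕ ℕ ≃ ℕ := Equiv.natSumNatEquivNat
    refine ⟨Sum.elim l₁ l₂ ∘ E.symm, Sum.elim c₁ c₂ ∘ E.symm, ⟨?_, ?_, |C₁| + |C₂|, N₁ + N₂, ?_⟩, ?_⟩
    · intro m
      rcases h : E.symm m with i | i <;> simp [h, hn₁, hn₂]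
    · intro R
      refine (((hf₁ R).image (fun i => E (Sum.inl i))).union
        ((hf₂ R).image (fun i => E (Sum.inr i)))).subset fun m hm => ?_
      rcases h : E.symm m with i | i
      · exact Or.inl ⟨i, by simpa [h] using hm, by simp [← h]⟩
      · exact Or.inr ⟨i, by simpa [h] using hm, by simp [← h]⟩
    · intro R hR s hs
      have key : ∑ m ∈ s, ‖(Sum.elim c₁ c₂ ∘ E.symm) m‖
          = ∑ i ∈ (s.map E.symm.toEmbedding).toLeft, ‖c₁ i‖
            + ∑ i ∈ (s.map E.symm.toEmbedding).toRight, ‖c₂ i‖ := by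
        have h1 : ∑ m ∈ s, ‖(Sum.elim c₁ c₂ ∘ E.symm) m‖
            = ∑ x ∈ s.map E.symm.toEmbedding, ‖Sum.elim c₁ c₂ x‖ := by simp
        rw [h1, ← Finset.toLeft_disjSum_toRight (u := s.map E.symm.toEmbedding),
          Finset.sum_disjSum]
        simp
      have b₁ := hp₁ R hR (s.map E.symm.toEmbedding).toLeft fun i hi => by
        simp only [Finset.mem_toLeft, Finset.mem_map_equiv, Equiv.symm_symm] at hi
        simpa using hs _ hi
      have b₂ := hp₂ R hR (s.map E.symm.toEmbedding).toRight fun i hi => by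
        simp only [Finset.mem_toRight, Finset.mem_map_equiv, Equiv.symm_symm] at hi
        simpa using hs _ hi
      have hR1 : (1 : ℝ) ≤ 1 + R := by linarith
      rw [key, add_mul]
      refine add_le_add (b₁.trans ?_) (b₂.trans ?_)
      · exact mul_le_mul (le_abs_self _) (pow_le_pow_right₀ hR1 (by omega)) (by positivity)
          (abs_nonneg _)
      · exact mul_le_mul (le_abs_self _) (pow_le_pow_right₀ hR1 (by omega)) (by positivity)
          (abs_nonneg _)
    · rw [← E.hasSum_iff]
      have : (fun m => (Sum.elim c₁ c₂ ∘ E.symm) m • e ((Sum.elim l₁ l₂ ∘ E.symm) m)) ∘ E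
          = Sum.elim (fun m => c₁ m • e (l₁ m)) (fun m => c₂ m • e (l₂ m)) := by
        funext x
        rcases x with i | i <;> simp
      rw [this]
      exact HasSum.sum (f := Sum.elim (fun m => c₁ m • e (l₁ m)) (fun m => c₂ m • e (l₂ m)))
        (by simpa using! hs₁) (by simpa using! hs₂)
  smul_mem' := by
    rintro a v ⟨l, c, ⟨hn, hf, C, N, hp⟩, hs⟩
    refine ⟨l, fun m => a * c m, ⟨hn, hf, ‖a‖ * C, N, ?_⟩, ?_⟩
    · intro R hR s h
      simp only [norm_mul, ← Finset.mul_sum, mul_assoc]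
      exact mul_le_mul_of_nonneg_left (hp R hR s h) (norm_nonneg a)
    · simpa [mul_smul] using hs.const_smul a

/-! ## The space of spherical measures -/

/-- `Meas_k`, the space of `k`-spherical measures: tempered distributions `μ` on `ℝ^k` with
`μ = ∑ c_m δ_{S_{lam_m}^k}` and `μ̂ = ∑ c'_m δ_{S_{lam'_m}^k}`, both sequences admissible. -/
def Meas (k : ℕ) : Submodule ℂ 𝓢'(Eucl k, ℂ) :=
  seriesSpace (sphereDist k) ⊓
    (seriesSpace (sphereDist k)).comap
      (FourierTransform.fourierCLM ℂ 𝓢'(Eucl k, ℂ)).toLinearMap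

/-! ## The space of Fourier series -/

/-- `τ ↦ e(lam τ / 2) = exp(π i lam τ)`. -/
def expo (lam : ℝ) (τ : ℍ) : ℂ := Complex.exp (2 * Real.pi * Complex.I * (lam * τ / 2))

/-- The point `-1/τ` of the upper half plane. -/
def negInv (τ : ℍ) : ℍ := .mk (-(τ : ℂ))⁻¹ τ.im_inv_neg_coe_pos

/-- The principal branch `√(-iτ)`. -/
def sqrtNegI (τ : ℍ) : ℂ := (-Complex.I * τ) ^ (1 / 2 : ℂ)

/-- `f ↦ f̃`, where `f̃(τ) = √(-iτ)^{-k} f(-1/τ)`. -/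
def tilde (k : ℕ) : (ℍ → ℂ) →ₗ[ℂ] (ℍ → ℂ) where
  toFun f τ := (sqrtNegI τ ^ k)⁻¹ * f (negInv τ)
  map_add' f g := by funext τ; simp [mul_add]
  map_smul' a f := by funext τ; simp; ring

/-- The space of holomorphic functions on the upper half plane. -/
def holo : Submodule ℂ (ℍ → ℂ) where
  carrier := {f | MDiff f}
  zero_mem' := mdifferentiable_const
  add_mem' hf hg := hf.add hg
  smul_mem' a _ hf := hf.const_smul a

/-- `FS_k`: the holomorphic functions `f` on the upper half plane such that
`f(τ) = ∑ c_m e(lam_m τ / 2)` and `f̃(τ) = ∑ c'_m e(lam'_m τ / 2)` for all `τ`, both sequences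
admissible. -/
def FS (k : ℕ) : Submodule ℂ (ℍ → ℂ) :=
  holo ⊓ seriesSpace expo ⊓ (seriesSpace expo).comap (tilde k)

/-! ## The theta map -/

lemma gauss_decay (M : ℕ) {b : ℝ} (hb : 0 < b) :
    ∃ C : ℝ, ∀ t : ℝ, 0 ≤ t → (1 + t) ^ M * Real.exp (-(b * t ^ 2)) ≤ C := by
  refine ⟨(M.factorial : ℝ) / b ^ M * Real.exp (2 * b), fun t ht => ?_⟩
  have h := Real.pow_div_factorial_le_exp (x := b * (1 + t)) (by positivity) M
  have h2 : (1 + t) ^ M ≤ (M.factorial : ℝ) / b ^ M * Real.exp (b * (1 + t)) := by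
    rw [mul_pow, div_le_iff₀ (by positivity)] at h
    rw [div_mul_eq_mul_div, le_div_iff₀ (by positivity)]
    linarith
  calc _ ≤ (M.factorial : ℝ) / b ^ M * Real.exp (b * (1 + t)) * Real.exp (-(b * t ^ 2)) := by
        gcongr
    _ = (M.factorial : ℝ) / b ^ M * Real.exp (b * (1 + t) + -(b * t ^ 2)) := by
        rw [mul_assoc, Real.exp_add]
    _ ≤ _ := by
        gcongr
        nlinarith [mul_nonneg hb.le (sq_nonneg (t - 1)), mul_nonneg hb.le (sq_nonneg t)]

lemma contDiff_cexp_mul (a : ℂ) : ContDiff ℝ ∞ fun t : ℝ => Complex.exp (a * t) := by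
  have : ContDiff ℝ ∞ (fun t : ℝ => (t : ℂ)) := Complex.ofRealCLM.contDiff
  fun_prop

lemma iteratedDeriv_cexp_mul (a : ℂ) (n : ℕ) :
    iteratedDeriv n (fun t : ℝ => Complex.exp (a * t)) = fun t : ℝ => a ^ n * Complex.exp (a * t) := by
  induction n with
  | zero => simp
  | succ n ih =>
    rw [iteratedDeriv_succ, ih]
    funext t
    have h : HasDerivAt (fun t : ℝ => Complex.exp (a * t)) (Complex.exp (a * t) * (a * 1)) t :=
      ((Complex.ofRealCLM.hasDerivAt (x := t)).const_mul a).cexp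
    rw [(h.const_mul (a ^ n)).deriv]
    ring

lemma norm_iteratedFDeriv_cexp_mul (a : ℂ) (n : ℕ) (t : ℝ) :
    ‖iteratedFDeriv ℝ n (fun t : ℝ => Complex.exp (a * t)) t‖
      = ‖a‖ ^ n * Real.exp (a.re * t) := by
  rw [norm_iteratedFDeriv_eq_norm_iteratedDeriv, iteratedDeriv_cexp_mul]
  simp [Complex.norm_exp]

/-- The Gaussian `g(x, τ) = e(xᵀx τ / 2)` as a Schwartz function of `x`. -/
def gaussian (k : ℕ) (τ : ℍ) : 𝓢(Eucl k, ℂ) where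
  toFun x := Complex.exp (2 * Real.pi * Complex.I * ((‖x‖ ^ 2 : ℝ) * τ / 2))
  smooth' := by
    have h : ContDiff ℝ ∞ fun x : Eucl k => ‖x‖ ^ 2 := contDiff_norm_sq ℝ
    have := (contDiff_cexp_mul (Real.pi * Complex.I * τ)).comp h
    convert this using 2 with x
    simp only [Function.comp]
    congr 1
    ring
  decay' := by
    intro p n
    set a : ℂ := Real.pi * Complex.I * τ with ha
    have hare : a.re = -(Real.pi * τ.im) := by simp [ha]
    have hb : 0 < Real.pi * τ.im := mul_pos Real.pi_pos τ.im_pos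
    obtain ⟨q, C, hC, hq⟩ := (Function.hasTemperateGrowth_norm_sq
      (H := Eucl k)).norm_iteratedFDeriv_le_uniform n
    obtain ⟨K, hK⟩ := gauss_decay (p + q * n) hb
    refine ⟨n.factorial * (1 + ‖a‖) ^ n * (1 + C) ^ n * K, fun x => ?_⟩
    have hfun : (fun x : Eucl k =>
        Complex.exp (2 * Real.pi * Complex.I * ((‖x‖ ^ 2 : ℝ) * τ / 2)))
        = (fun t : ℝ => Complex.exp (a * t)) ∘ fun x : Eucl k => ‖x‖ ^ 2 := by
      funext x
      simp only [Function.comp, ha]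
      congr 1
      ring
    have hx : (1 : ℝ) ≤ 1 + ‖x‖ := by linarith [norm_nonneg x]
    have hbd := norm_iteratedFDeriv_comp_le (n := n) (N := ∞) (contDiff_cexp_mul a)
      (contDiff_norm_sq ℝ : ContDiff ℝ ∞ fun x : Eucl k => ‖x‖ ^ 2) (mod_cast le_top) x
      (C := (1 + ‖a‖) ^ n * Real.exp (-(Real.pi * τ.im * ‖x‖ ^ 2)))
      (D := (1 + C) * (1 + ‖x‖) ^ q)
      (fun i hi => by
        rw [norm_iteratedFDeriv_cexp_mul, hare, neg_mul]
        gcongr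
        calc ‖a‖ ^ i ≤ (1 + ‖a‖) ^ i := by gcongr; linarith
          _ ≤ (1 + ‖a‖) ^ n := pow_le_pow_right₀ (by linarith [norm_nonneg a]) hi)
      (fun i hi hin => by
        calc _ ≤ C * (1 + ‖x‖) ^ q := hq i hin x
          _ ≤ (1 + C) * (1 + ‖x‖) ^ q := by gcongr; linarith
          _ ≤ _ := le_self_pow₀
            (one_le_mul_of_one_le_of_one_le (by linarith) (one_le_pow₀ hx)) (by omega))
    rw [hfun]
    calc _ ≤ (1 + ‖x‖) ^ p * (n.factorial * ((1 + ‖a‖) ^ n *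
            Real.exp (-(Real.pi * τ.im * ‖x‖ ^ 2))) * ((1 + C) * (1 + ‖x‖) ^ q) ^ n) := by
          gcongr
          linarith
      _ = n.factorial * (1 + ‖a‖) ^ n * (1 + C) ^ n *
            ((1 + ‖x‖) ^ (p + q * n) * Real.exp (-(Real.pi * τ.im * ‖x‖ ^ 2))) := by
          rw [mul_pow, ← pow_mul, pow_add]
          ring
      _ ≤ _ := by
          gcongr
          exact hK _ (norm_nonneg x)

/-- The theta function `θ_μ(τ) = ⟨μ, g(·, τ)⟩` of a tempered distribution `μ`. -/
def theta {k : ℕ} (μ : 𝓢'(Eucl k, ℂ)) (τ : ℍ) : ℂ := μ (gaussian k τ)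

/-! ## The metaplectic group -/

/-- The metaplectic group `Mp₂(ℝ)`: pairs `(M, φ)` with `M = (a b; c d)` in `SL₂(ℝ)` and
`φ` holomorphic on the upper half plane with `φ(τ)² = c τ + d`. -/
@[ext]
structure Mp2 where
  mat : SL(2, ℝ)
  phi : ℍ → ℂ
  mdiff : MDiff phi
  sq : ∀ τ : ℍ, phi τ ^ 2 = (mat 1 0 : ℂ) * τ + (mat 1 1 : ℂ)

namespace Mp2

lemma sq_denom (g : Mp2) (τ : ℍ) : g.phi τ ^ 2 = UpperHalfPlane.denom g.mat τ := by
  simp [g.sq, UpperHalfPlane.denom]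

lemma phi_ne_zero (g : Mp2) (τ : ℍ) : g.phi τ ≠ 0 := by
  intro h
  have := g.sq_denom τ
  rw [h] at this
  exact UpperHalfPlane.denom_ne_zero (g.mat : GL (Fin 2) ℝ) τ (by simpa using this.symm)

lemma denom_mul (M N : SL(2, ℝ)) (τ : ℍ) : UpperHalfPlane.denom (M * N : SL(2, ℝ)) τ
    = UpperHalfPlane.denom M (N • τ : ℍ) * UpperHalfPlane.denom N τ := by
  have h := UpperHalfPlane.denom_cocycle_σ (M : GL (Fin 2) ℝ) (N : GL (Fin 2) ℝ) τ
  have h' : UpperHalfPlane.denom ((M : GL (Fin 2) ℝ) * (N : GL (Fin 2) ℝ)) τ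
      = UpperHalfPlane.denom M ((N : GL (Fin 2) ℝ) • τ : ℍ) * UpperHalfPlane.denom N τ := by
    simpa [UpperHalfPlane.σ] using h
  rw [map_mul]
  exact h'

lemma mdiff_smul (M : SL(2, ℝ)) : MDiff fun τ : ℍ => M • τ :=
  UpperHalfPlane.mdifferentiable_smul (g := (M : GL (Fin 2) ℝ)) (by simp)

lemma mdiff_inv {f : ℍ → ℂ} (hf : MDiff f) (h0 : ∀ τ, f τ ≠ 0) :
    MDiff fun τ => (f τ)⁻¹ := by
  rw [UpperHalfPlane.mdifferentiable_iff] at hf ⊢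
  exact hf.inv fun z _ => h0 _

/-- `(M₁, φ₁) (M₂, φ₂) = (M₁ M₂, φ₁(M₂ ·) φ₂)`. -/
instance : Mul Mp2 where
  mul g h :=
    { mat := g.mat * h.mat
      phi := fun τ => g.phi (h.mat • τ) * h.phi τ
      mdiff := (g.mdiff.comp (mdiff_smul h.mat)).mul h.mdiff
      sq := fun τ => by
        have := denom_mul g.mat h.mat τ
        rw [mul_pow, sq_denom, sq_denom, ← this]
        simp [UpperHalfPlane.denom] }

instance : One Mp2 where
  one := { mat := 1, phi := fun _ => 1, mdiff := mdifferentiable_const, sq := fun τ => by simp }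

/-- `(M, φ)⁻¹ = (M⁻¹, 1 / φ(M⁻¹ ·))`. -/
instance : Inv Mp2 where
  inv g :=
    { mat := g.mat⁻¹
      phi := fun τ => (g.phi (g.mat⁻¹ • τ))⁻¹
      mdiff := mdiff_inv (g.mdiff.comp (mdiff_smul g.mat⁻¹)) fun τ => g.phi_ne_zero _
      sq := fun τ => by
        have h := denom_mul g.mat g.mat⁻¹ τ
        have h1 : UpperHalfPlane.denom (1 : SL(2, ℝ)) τ = 1 := by simp [UpperHalfPlane.denom]
        rw [mul_inv_cancel, h1] at h
        rw [inv_pow, sq_denom, ← eq_inv_of_mul_eq_one_right h.symm]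
        rfl }

lemma mul_mat (g h : Mp2) : (g * h).mat = g.mat * h.mat := rfl
lemma mul_phi (g h : Mp2) (τ : ℍ) : (g * h).phi τ = g.phi (h.mat • τ) * h.phi τ := rfl
lemma one_mat : (1 : Mp2).mat = 1 := rfl
lemma one_phi (τ : ℍ) : (1 : Mp2).phi τ = 1 := rfl
lemma inv_mat (g : Mp2) : (g⁻¹).mat = g.mat⁻¹ := rfl
lemma inv_phi (g : Mp2) (τ : ℍ) : (g⁻¹).phi τ = (g.phi (g.mat⁻¹ • τ))⁻¹ := rfl

instance : Group Mp2 :=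
  Group.ofLeftAxioms
    (fun f g h => by
      ext τ
      · simp [mul_mat, mul_assoc]
      · simp [mul_phi, mul_mat, mul_smul, mul_assoc])
    (fun g => by
      ext τ
      · simp [mul_mat, one_mat]
      · simp [mul_phi, one_phi])
    (fun g => by
      ext τ
      · simp [mul_mat, inv_mat, one_mat]
      · simp [mul_phi, inv_phi, one_phi, g.phi_ne_zero])

end Mp2

/-- The slash operator of weight `k/2`: `(f|_{k/2} (M, φ))(τ) = φ(τ)^{-k} f(M τ)`. -/
def slash (k : ℕ) (f : ℍ → ℂ) (g : Mp2) (τ : ℍ) : ℂ := (g.phi τ ^ k)⁻¹ * f (g.mat • τ)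

/-! ## The Schrödinger model of the Weil representation -/

lemma chirp_hasTemperateGrowth (k : ℕ) (b : ℝ) : Function.HasTemperateGrowth
    fun x : Eucl k => Complex.exp (2 * Real.pi * Complex.I * ((‖x‖ ^ 2 : ℝ) * b / 2)) := by
  have h1 : Function.HasTemperateGrowth
      fun t : ℝ => Complex.exp ((Real.pi * Complex.I * b) * t) := by
    refine ⟨contDiff_cexp_mul _, fun n => ⟨0, ‖Real.pi * Complex.I * (b : ℂ)‖ ^ n, fun t => ?_⟩⟩
    rw [norm_iteratedFDeriv_cexp_mul]
    simp
  have h2 := h1.comp (Function.hasTemperateGrowth_norm_sq (H := Eucl k))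
  have h3 : (fun x : Eucl k => Complex.exp (2 * Real.pi * Complex.I * ((‖x‖ ^ 2 : ℝ) * b / 2)))
      = (fun t : ℝ => Complex.exp ((Real.pi * Complex.I * b) * t)) ∘ fun x => ‖x‖ ^ 2 := by
    funext x
    simp only [Function.comp]
    congr 1
    ring
  rw [h3]
  exact h2

/-- Multiplication of Schwartz functions by `e(xᵀx b / 2)`. -/
def chirp (k : ℕ) (b : ℝ) : 𝓢(Eucl k, ℂ) →L[ℂ] 𝓢(Eucl k, ℂ) :=
  SchwartzMap.smulLeftCLM ℂ
    fun x : Eucl k => Complex.exp (2 * Real.pi * Complex.I * ((‖x‖ ^ 2 : ℝ) * b / 2))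

/-- The operator `f ↦ f(u ·)` on Schwartz functions, for `u ≠ 0`. -/
def dilate (k : ℕ) (u : ℝˣ) : 𝓢(Eucl k, ℂ) →L[ℂ] 𝓢(Eucl k, ℂ) :=
  SchwartzMap.compCLMOfContinuousLinearEquiv ℂ (ContinuousLinearEquiv.smulLeft u)

lemma chirp_apply (k : ℕ) (b : ℝ) (f : 𝓢(Eucl k, ℂ)) (x : Eucl k) :
    chirp k b f x = Complex.exp (2 * Real.pi * Complex.I * ((‖x‖ ^ 2 : ℝ) * b / 2)) * f x :=
  SchwartzMap.smulLeftCLM_apply_apply (chirp_hasTemperateGrowth k b) f x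

lemma dilate_apply (k : ℕ) (u : ℝˣ) (f : 𝓢(Eucl k, ℂ)) (x : Eucl k) :
    dilate k u f x = f ((u : ℝ) • x) := rfl

lemma d_ne_zero (M : SL(2, ℝ)) (hc : M 1 0 = 0) : M 1 1 ≠ 0 := by
  intro hd
  have := M.det_coe
  rw [Matrix.det_fin_two, hc, hd] at this
  simp at this

/-- The point `-d/c + i/c²` of the upper half plane. -/
def basePoint (c d : ℝ) (hc : c ≠ 0) : ℍ :=
  .mk (((-(d / c) : ℝ) : ℂ) + ((1 / c ^ 2 : ℝ) : ℂ) * Complex.I) (by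
    simp only [Complex.add_im, Complex.ofReal_im, Complex.im_ofReal_mul,
      Complex.I_im, mul_one, zero_add]
    positivity)

/-- The Weil representation `ω(M, φ)` of `Mp₂(ℝ)` on Schwartz functions on `ℝ^k`. With
`M = (a b; c d)`,
* `ω(M, φ) f(x) = φ^k e(-b d xᵀx / 2) f(d x)` if `c = 0` (then `φ` is constant);
* `ω(M, φ) f(x) = φ(-d/c + i/c²)^k e(-d xᵀx / (2c)) ∫ f(y) e(-a yᵀy / (2c)) e(xᵀy / c) dy`
  if `c ≠ 0`.

In particular `ω(rot a) f(x) = √a^{-k} f(x/a)` for `rot a = (diag(a, a⁻¹), a^{-1/2})`, `a > 0`,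
`ω(t b) f(x) = e(-xᵀx b / 2) f(x)` for `t b = ((1 b; 0 1), 1)`, and `ω(S) f(x) = √i^k f̂(-x)`
for `S = ((0 -1; 1 0), √τ)`. These elements generate `Mp₂(ℝ)`, and `ω` is the extension from them
with `ω(M₁ M₂) = ω(M₂) ω(M₁)`. -/
def weil (k : ℕ) (g : Mp2) : 𝓢(Eucl k, ℂ) →L[ℂ] 𝓢(Eucl k, ℂ) :=
  if hc : g.mat 1 0 = 0 then
    g.phi UpperHalfPlane.I ^ k •
      (chirp k (-(g.mat 0 1 * g.mat 1 1))).comp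
        (dilate k (Units.mk0 (g.mat 1 1) (d_ne_zero g.mat hc)))
  else
    g.phi (basePoint (g.mat 1 0) (g.mat 1 1) hc) ^ k •
      (chirp k (-(g.mat 1 1 / g.mat 1 0))).comp
        ((dilate k (Units.mk0 (g.mat 1 0)⁻¹ (inv_ne_zero hc))).comp
          ((FourierTransform.fourierInvCLM ℂ 𝓢(Eucl k, ℂ)).comp
            (chirp k (-(g.mat 0 0 / g.mat 1 0)))))

/-- The action of `Mp₂(ℝ)` on tempered distributions: `⟨μ|M, f⟩ = ⟨μ, ω(M⁻¹) f⟩`. -/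
def distSlash {k : ℕ} (μ : 𝓢'(Eucl k, ℂ)) (g : Mp2) : 𝓢'(Eucl k, ℂ) :=
  PointwiseConvergenceCLM.precomp ℂ (weil k g⁻¹) μ

lemma distSlash_apply {k : ℕ} (μ : 𝓢'(Eucl k, ℂ)) (g : Mp2) (f : 𝓢(Eucl k, ℂ)) :
    distSlash μ g f = μ (weil k g⁻¹ f) := rfl

end SphericalMeasure

end

noncomputable section

namespace SphericalMeasure

open Filter Topology Finset MeasureTheory
open scoped Pointwise RealInnerProductSpace

/-! ## Summability of admissible series -/

/-! A Gaussian is constant on spheres about the origin, so the normalized surface measure of radius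
`√s` pairs with `g(·, τ)` to give `e(sτ/2)`: `θ` turns spherical series into exponential series with
coefficients rescaled by sphere volumes. The Fourier transform maps `g(·, τ)` to `√(-iτ)^{-k} g(·,
-1/τ)`, so `θ` turns `μ ↦ μ̂` into `f ↦ f̃` (`theta_fourier`).

Injectivity is uniqueness of generalized Dirichlet series: letting `τ → i∞` isolates the smallest
exponent whose total coefficient is nonzero (`IsAdmissible.tsum_fiber_eq_zero`). Part (3) follows
from injectivity and the intertwining. Part (2) is a computation on Gaussians (`weil_gaussian`),
with branches of square roots compared by continuity.

The main point is surjectivity. The coefficients of `f` and `f̃` define tempered distributions `μ`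
and `ν`, and `μ̂ = ν` must be shown (`fourier_spherical_series`). It suffices to test on a dense
set, namely Gaussian times band-limited Schwartz function. The spherical means of a band-limited
function form an entire function `∑ b_j s^j` with `∑ |b_j| j! < ∞`. By Cauchy's formula it is a
superposition of the exponentials `exp(s e^{iθ})`, and the Gaussian factor turns these into `e(s
T(θ)/2)` with `T(θ)` on a circle inside the upper half plane. Only spherical means enter `ν φ`, and
by polar coordinates also `μ φ̂`. Hence both are integrals over `θ`, of `f̃(T)` and of `√(-iT)^{-k}
f(-1/T)`, and these integrands agree by the definition of `f̃`. -/

lemma IsAdmissible.exists_summable_div_pow {lam : ℕ → ℝ} {c : ℕ → ℂ} (h : IsAdmissible lam c) :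
    ∃ N : ℕ, Summable fun m => ‖c m‖ / (1 + lam m) ^ N := by
  obtain ⟨C, N, hC⟩ := h.polyGrowth
  have hC0 : 0 ≤ C := by simpa using hC 0 le_rfl ∅ (by simp)
  have hs : Summable fun n : ℕ => C * 2 ^ N * (1 / ((n : ℝ) + 1) ^ 2) :=
    ((summable_nat_add_iff 1).2 (Real.summable_one_div_nat_pow.2 one_lt_two)).mul_left _ |>.congr
      fun n => by push_cast; rfl
  refine ⟨N + 2, summable_of_sum_le (c := ∑' n : ℕ, C * 2 ^ N * (1 / ((n : ℝ) + 1) ^ 2))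
    (fun m => div_nonneg (norm_nonneg _) (pow_nonneg (by linarith [h.nonneg m]) _)) fun s => ?_⟩
  -- Group by integer part: block `n` contributes at most `C (n+2)^N / (n+1)^{N+2} ≤ C 2^N /
  -- (n+1)^2`, which is why the exponent is `N + 2`.
  rw [← Finset.sum_fiberwise_of_maps_to (t := s.image fun m => ⌊lam m⌋₊)
    (g := fun m => ⌊lam m⌋₊) fun m hm => Finset.mem_image_of_mem _ hm]
  refine (Finset.sum_le_sum fun n _ => ?_).trans
    (hs.sum_le_tsum _ fun n _ => by positivity)
  have h1 := hC (n + 1) (by positivity) (s.filter fun m => ⌊lam m⌋₊ = n) fun m hm => by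
    rw [← (Finset.mem_filter.1 hm).2]
    exact (Nat.lt_floor_add_one _).le
  calc ∑ m ∈ s with ⌊lam m⌋₊ = n, ‖c m‖ / (1 + lam m) ^ (N + 2)
      ≤ ∑ m ∈ s with ⌊lam m⌋₊ = n, ‖c m‖ / ((n : ℝ) + 1) ^ (N + 2) := by
        refine Finset.sum_le_sum fun m hm => ?_
        have : (n : ℝ) ≤ lam m := by
          rw [← (Finset.mem_filter.1 hm).2]
          exact Nat.floor_le (h.nonneg m)
        exact div_le_div_of_nonneg_left (norm_nonneg _) (by positivity)
          (pow_le_pow_left₀ (by positivity) (by linarith) _)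
    _ ≤ C * (1 + (n + 1)) ^ N / ((n : ℝ) + 1) ^ (N + 2) := by
        rw [← Finset.sum_div]
        gcongr
    _ ≤ C * (2 * (n + 1)) ^ N / ((n : ℝ) + 1) ^ (N + 2) := by
        gcongr
        linarith [Nat.cast_nonneg (α := ℝ) n]
    _ = _ := by
        rw [mul_pow, pow_add]
        field_simp

lemma exists_one_add_pow_mul_exp_le (N : ℕ) {b : ℝ} (hb : 0 < b) :
    ∃ K : ℝ, ∀ t : ℝ, 0 ≤ t → (1 + t) ^ N * Real.exp (-(b * t)) ≤ K := by
  refine ⟨(N.factorial : ℝ) / b ^ N * Real.exp b, fun t ht => ?_⟩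
  have h := Real.pow_div_factorial_le_exp (x := b * (1 + t)) (by positivity) N
  have h2 : (1 + t) ^ N ≤ (N.factorial : ℝ) / b ^ N * Real.exp (b * (1 + t)) := by
    rw [mul_pow, div_le_iff₀ (by positivity)] at h
    rw [div_mul_eq_mul_div, le_div_iff₀ (by positivity)]
    linarith
  calc _ ≤ (N.factorial : ℝ) / b ^ N * Real.exp (b * (1 + t)) * Real.exp (-(b * t)) := by
        gcongr
    _ = (N.factorial : ℝ) / b ^ N * Real.exp b := by
        rw [mul_assoc, ← Real.exp_add]
        congr 2
        ring

lemma IsAdmissible.summable_exp {lam : ℕ → ℝ} {c : ℕ → ℂ} (h : IsAdmissible lam c) {b : ℝ}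
    (hb : 0 < b) : Summable fun m => ‖c m‖ * Real.exp (-(b * lam m)) := by
  obtain ⟨N, hN⟩ := h.exists_summable_div_pow
  obtain ⟨K, hK⟩ := exists_one_add_pow_mul_exp_le N hb
  refine Summable.of_nonneg_of_le (fun m => by positivity) (fun m => ?_) (hN.mul_left K)
  have hp : 0 < (1 + lam m) ^ N := pow_pos (by linarith [h.nonneg m]) _
  have := hK (lam m) (h.nonneg m)
  rw [mul_div_assoc', le_div_iff₀ hp]
  calc _ = ‖c m‖ * ((1 + lam m) ^ N * Real.exp (-(b * lam m))) := by ring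
    _ ≤ ‖c m‖ * K := by gcongr
    _ = _ := mul_comm _ _

lemma norm_expo (lam : ℝ) (τ : ℍ) : ‖expo lam τ‖ = Real.exp (-(Real.pi * τ.im * lam)) := by
  rw [expo, Complex.norm_exp]
  congr 1
  simp
  ring

lemma norm_expo_le {lam : ℝ} (hl : 0 ≤ lam) {τ : ℍ} {y : ℝ} (hy : y ≤ τ.im) :
    ‖expo lam τ‖ ≤ Real.exp (-(Real.pi * y * lam)) := by
  rw [norm_expo, Real.exp_le_exp, neg_le_neg_iff]
  gcongr

lemma hasSum_seriesSpace_expo_iff {lam : ℕ → ℝ} {c : ℕ → ℂ} {f : ℍ → ℂ} :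
    HasSum (fun m => c m • expo (lam m)) f ↔ ∀ τ, HasSum (fun m => c m * expo (lam m) τ) (f τ) :=
  Pi.hasSum

lemma hasSum_temperedDistribution_iff {k : ℕ} {ι : Type*} {u : ι → 𝓢'(Eucl k, ℂ)}
    {μ : 𝓢'(Eucl k, ℂ)} : HasSum u μ ↔ ∀ φ, HasSum (fun m => u m φ) (μ φ) := by
  simp only [HasSum, PointwiseConvergenceCLM.tendsto_iff_forall_tendsto]
  refine forall_congr' fun φ => ?_
  have h : ∀ s : Finset ι, (∑ m ∈ s, u m) φ = ∑ m ∈ s, u m φ := fun s =>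
    map_sum (PointwiseConvergenceCLM.evalCLM (RingHom.id ℂ) ℂ φ) u s
  simp_rw [h]

/-- A convergent admissible series is holomorphic. -/
lemma IsAdmissible.mdiff {lam : ℕ → ℝ} {c : ℕ → ℂ} (h : IsAdmissible lam c) {f : ℍ → ℂ}
    (hf : ∀ τ, HasSum (fun m => c m * expo (lam m) τ) (f τ)) : MDiff f := by
  rw [UpperHalfPlane.mdifferentiable_iff]
  intro z hz
  set y : ℝ := z.im / 2
  have hy : 0 < y := half_pos hz
  have hU : IsOpen {w : ℂ | y < w.im} := isOpen_lt continuous_const Complex.continuous_im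
  have hd : DifferentiableOn ℂ (fun w => ∑' m, c m *
      Complex.exp (2 * Real.pi * Complex.I * (lam m * w / 2))) {w : ℂ | y < w.im} := by
    refine Complex.differentiableOn_tsum_of_summable_norm
      (h.summable_exp (mul_pos Real.pi_pos hy)) (fun m => ?_) hU fun m w hw => ?_
    · exact (by fun_prop : Differentiable ℂ _).differentiableOn
    · rw [norm_mul]
      have hw' : y < w.im := hw
      gcongr
      exact norm_expo_le (h.nonneg m) (τ := ⟨w, hy.trans hw'⟩) hw'.le
  have hz' : z ∈ {w : ℂ | y < w.im} := half_lt_self (show 0 < z.im from hz)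
  refine ((hd.differentiableAt (hU.mem_nhds hz')).congr_of_eventuallyEq ?_).differentiableWithinAt
  filter_upwards [hU.mem_nhds hz'] with w hw
  have hw0 : 0 < w.im := hy.trans hw
  simp only [Function.comp, UpperHalfPlane.ofComplex_apply_of_im_pos hw0]
  exact (hf ⟨w, hw0⟩).tsum_eq.symm

/-! ## Uniqueness of expansions -/

/-- Exponents may repeat, so a series determines only the total coefficient over each fibre of
`lam`; this regrouping is how such totals enter. -/
lemma hasSum_tsum_fiber {ι γ : Type*} {f : ι → ℂ} {a : ℂ} (hf : HasSum f a) (g : ι → γ) :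
    HasSum (fun r => ∑' m : {m // g m = r}, f m) a := by
  have := ((Equiv.sigmaFiberEquiv g).hasSum_iff (f := f)).2 hf
  exact this.sigma fun r => (this.summable.sigma_factor r).hasSum

/-- If a convergent admissible series vanishes identically, then for every `r` the coefficients
with `lam m = r` add up to zero. -/
lemma IsAdmissible.tsum_fiber_eq_zero {lam : ℕ → ℝ} {c : ℕ → ℂ} (h : IsAdmissible lam c)
    (h0 : ∀ τ, HasSum (fun m => c m * expo (lam m) τ) 0) (r : ℝ) :
    ∑' m : {m // lam m = r}, c m = 0 := by
  classical
  by_contra hr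
  set S : Set ℝ := {s | ∑' m : {m // lam m = s}, c m ≠ 0} with hS
  -- Local finiteness provides a least exponent `r₀` with nonzero total coefficient.
  have hfin : (S ∩ Set.Iic r).Finite := by
    refine ((h.locallyFinite r).image lam).subset ?_
    rintro s ⟨hs, hsr⟩
    by_contra hne
    have : IsEmpty {m // lam m = s} := ⟨fun m => hne ⟨m, by simpa [m.2] using hsr, m.2⟩⟩
    exact hs (by simp)
  obtain ⟨r₀, ⟨hr₀S, hr₀⟩, hmin⟩ :=
    hfin.exists_minimal (s := S ∩ Set.Iic r) ⟨r, hr, Set.mem_Iic.2 le_rfl⟩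
  have hlt : ∀ s < r₀, ∑' m : {m // lam m = s}, c m = 0 := by
    intro s hs
    by_contra hne
    exact absurd (hmin ⟨hne, hs.le.trans hr₀⟩ hs.le) (not_le.2 hs)
  -- the terms with `lam m ≥ r₀`, normalized
  let F : ℕ → ℕ → ℂ := fun y m =>
    if r₀ ≤ lam m then c m * (Real.exp (-((y + 1) * (lam m - r₀))) : ℝ) else 0
  have hF0 : ∀ y, ∑' m, F y m = 0 := by
    intro y
    -- At `τ = i(y+1)/π` the exponential becomes `exp(-(y+1)l)`. The shift by one lets the case `y =
    -- 0` dominate all others in the limit below.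
    have hy : 0 < ((y : ℝ) + 1) / Real.pi := by positivity
    let τ : ℍ := ⟨(((y : ℝ) + 1) / Real.pi : ℝ) * Complex.I, by simpa using hy⟩
    have he : ∀ l : ℝ, expo l τ = (Real.exp (-((y + 1) * l)) : ℝ) := by
      intro l
      rw [expo, Complex.ofReal_exp]
      congr 1
      have : (Real.pi : ℂ) ≠ 0 := mod_cast Real.pi_ne_zero
      change 2 * Real.pi * Complex.I * (l * ((((y : ℝ) + 1) / Real.pi : ℝ) * Complex.I) / 2) = _
      push_cast
      field_simp
      rw [Complex.I_sq]
      ring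
    have h1 := hasSum_tsum_fiber (h0 τ) lam
    have hFs : Summable (F y) := by
      have := ((h0 τ).summable.mul_right ((Real.exp ((y + 1) * r₀) : ℝ) : ℂ)).norm.of_norm
      refine Summable.of_norm_bounded this.norm fun m => ?_
      simp only [F]
      split_ifs
      · rw [he, mul_assoc, ← Complex.ofReal_mul, ← Real.exp_add]
        apply le_of_eq
        congr 4
        ring
      · simp only [norm_zero]
        positivity
    have h2 := hasSum_tsum_fiber hFs.hasSum lam
    -- Discarding the terms below `r₀` is harmless: their fibre totals vanish by minimality.
    have h3 : (fun r => ∑' m : {m // lam m = r}, F y m)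
        = fun r => (∑' m : {m // lam m = r}, c m * expo (lam m) τ) *
            (Real.exp ((y + 1) * r₀) : ℝ) := by
      funext s
      rw [← tsum_mul_right]
      rcases lt_or_ge s r₀ with hs | hs
      · have e1 : ∀ m : {m // lam m = s}, F y m = 0 := fun m => by
          simp [F, m.2, hs]
        have e2 : ∀ m : {m // lam m = s}, c m * expo (lam m) τ * (Real.exp ((y + 1) * r₀) : ℝ)
            = c m * (expo s τ * (Real.exp ((y + 1) * r₀) : ℝ)) := fun m => by
          rw [m.2, mul_assoc]
        simp_rw [e1, e2]
        rw [tsum_mul_right, hlt s hs]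
        simp
      · refine tsum_congr fun m => ?_
        simp only [F, m.2, hs, if_true]
        rw [he, mul_assoc, ← Complex.ofReal_mul, ← Real.exp_add]
        congr 3
        ring
    rw [h3] at h2
    have := h2.unique (h1.mul_right _)
    simpa using this
  -- As `y → ∞` only the terms with `lam m = r₀` survive, so their total is zero, a contradiction.
  have hlim : Tendsto (fun y => ∑' m, F y m) atTop
      (𝓝 (∑' m, if lam m = r₀ then c m else 0)) := by
    refine tendsto_tsum_of_dominated_convergence
      (bound := fun m => Real.exp r₀ * (‖c m‖ * Real.exp (-(1 * lam m))))
      ((h.summable_exp one_pos).mul_left _) (fun m => ?_) (Eventually.of_forall fun y m => ?_)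
    · rcases lt_trichotomy (lam m) r₀ with hm | hm | hm
      · simp [F, hm.not_ge, hm.ne]
      · simp [F, hm]
      · simp only [F, hm.le, hm.ne', if_true, if_false]
        rw [← mul_zero (c m), ← Complex.ofReal_zero]
        refine Tendsto.const_mul _ ((Complex.continuous_ofReal.tendsto 0).comp ?_)
        refine Real.tendsto_exp_neg_atTop_nhds_zero.comp ?_
        exact (tendsto_natCast_atTop_atTop.atTop_add tendsto_const_nhds).atTop_mul_const
          (sub_pos.2 hm)
    · simp only [F]
      split_ifs with hm
      · rw [norm_mul, Complex.norm_real, Real.norm_of_nonneg (Real.exp_pos _).le,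
          mul_left_comm, ← Real.exp_add]
        gcongr
        nlinarith [mul_nonneg (Nat.cast_nonneg (α := ℝ) y) (sub_nonneg.2 hm)]
      · rw [norm_zero]
        positivity
  simp only [hF0] at hlim
  have h4 := tendsto_nhds_unique hlim tendsto_const_nhds
  refine hr₀S ?_
  rw [← h4]
  exact (tsum_subtype {m | lam m = r₀} c).trans (by simp [Set.indicator_apply])

/-- An admissible series in `G (lam m)` vanishes if the corresponding exponential series does. -/
lemma IsAdmissible.hasSum_eq_zero {lam : ℕ → ℝ} {c : ℕ → ℂ} (h : IsAdmissible lam c)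
    (h0 : ∀ τ, HasSum (fun m => c m * expo (lam m) τ) 0) {G : ℝ → ℂ} {a : ℂ}
    (ha : HasSum (fun m => c m * G (lam m)) a) : a = 0 := by
  refine (hasSum_tsum_fiber ha lam).unique ?_
  have : (fun r => ∑' m : {m // lam m = r}, c m * G (lam m)) = fun _ => 0 := by
    funext r
    have e : ∀ m : {m // lam m = r}, c m * G (lam m) = c m * G r := fun m => by rw [m.2]
    simp_rw [e]
    rw [tsum_mul_right, h.tsum_fiber_eq_zero h0, zero_mul]
  rw [this]
  exact hasSum_zero

/-! ## Means over spheres -/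

/-- The uniform probability measure on the unit sphere. -/
def sphereProb (k : ℕ) : Measure (Metric.sphere (0 : Eucl k) 1) :=
  ((volume : Measure (Eucl k)).toSphere Set.univ)⁻¹ • (volume : Measure (Eucl k)).toSphere

/-- The mean of `f` over the sphere of radius `√s` about the origin. -/
def sphereMean (k : ℕ) (f : Eucl k → ℂ) (s : ℝ) : ℂ :=
  ∫ u : Metric.sphere (0 : Eucl k) 1, f (√s • (u : Eucl k)) ∂sphereProb k

/-- The area of the unit sphere. -/
def sphereArea (k : ℕ) : ℝ := (volume : Measure (Eucl k)).toSphere.real Set.univ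

section

variable {k : ℕ}

instance [NeZero k] : IsProbabilityMeasure (sphereProb k) := by
  have : NeZero (volume : Measure (Eucl k)).toSphere := ⟨Measure.toSphere_ne_zero _⟩
  unfold sphereProb
  infer_instance

lemma sphereArea_pos [NeZero k] : 0 < sphereArea k := by
  have : NeZero (volume : Measure (Eucl k)).toSphere := ⟨Measure.toSphere_ne_zero _⟩
  exact measureReal_univ_pos

lemma integral_toSphere [NeZero k] (f : Metric.sphere (0 : Eucl k) 1 → ℂ) :
    ∫ u, f u ∂(volume : Measure (Eucl k)).toSphere = sphereArea k * ∫ u, f u ∂sphereProb k := by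
  have h : (sphereArea k : ℂ) ≠ 0 := mod_cast sphereArea_pos.ne'
  rw [sphereProb, integral_smul_measure, Complex.real_smul, ENNReal.toReal_inv, Complex.ofReal_inv]
  exact (mul_inv_cancel_left₀ h _).symm

lemma sphereVol_zero : sphereVol k 0 = 1 := by
  simp [sphereVol, surfaceMeasure]

lemma sphereVol_of_pos {s : ℝ} (hs : 0 < s) : sphereVol k s = √s ^ (k - 1) * sphereArea k := by
  have hm : Measurable fun x : Metric.sphere (0 : Eucl k) 1 => √s • (x : Eucl k) := by fun_prop
  rw [sphereVol, surfaceMeasure, if_neg hs.ne', measureReal_ennreal_smul_apply,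
    ENNReal.toReal_ofReal (by positivity), map_measureReal_apply hm MeasurableSet.univ,
    Set.preimage_univ, sphereArea]

lemma sphereVol_pos [NeZero k] {s : ℝ} (hs : 0 ≤ s) : 0 < sphereVol k s := by
  rcases hs.eq_or_lt with rfl | hs
  · simp [sphereVol_zero]
  · rw [sphereVol_of_pos hs]
    have := sphereArea_pos (k := k)
    positivity

lemma integral_surfaceMeasure [NeZero k] {f : Eucl k → ℂ} (hf : Continuous f) {s : ℝ} (hs : 0 ≤ s) :
    ∫ x, f x ∂surfaceMeasure k s = sphereVol k s * sphereMean k f s := by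
  rcases hs.eq_or_lt with rfl | hs
  · simp [surfaceMeasure, sphereVol_zero, sphereMean]
  · rw [surfaceMeasure, if_neg hs.ne', integral_smul_measure, integral_map (by fun_prop)
      hf.aestronglyMeasurable, integral_toSphere, ENNReal.toReal_ofReal (by positivity),
      sphereVol_of_pos hs, sphereMean, Complex.real_smul]
    push_cast
    ring

lemma sphereDist_apply [NeZero k] (φ : 𝓢(Eucl k, ℂ)) {s : ℝ} (hs : 0 ≤ s) :
    sphereDist k s φ = sphereVol k s * sphereMean k φ s := by
  exact (Measure.toTemperedDistribution_apply (surfaceMeasure k s) φ).trans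
    (integral_surfaceMeasure φ.continuous hs)

lemma norm_sphere_smul {s : ℝ} (hs : 0 ≤ s) (u : Metric.sphere (0 : Eucl k) 1) :
    ‖√s • (u : Eucl k)‖ ^ 2 = s := by
  rw [norm_smul, norm_eq_of_mem_sphere, mul_one, Real.norm_of_nonneg (Real.sqrt_nonneg _),
    Real.sq_sqrt hs]

lemma sphereMean_congr {f g : Eucl k → ℂ} {s : ℝ} (hs : 0 ≤ s)
    (h : ∀ x, ‖x‖ ^ 2 = s → f x = g x) : sphereMean k f s = sphereMean k g s :=
  integral_congr_ae (Eventually.of_forall fun u => h _ (norm_sphere_smul hs u))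

lemma sphereMean_const [NeZero k] (a : ℂ) (s : ℝ) : sphereMean k (fun _ => a) s = a := by
  simp [sphereMean]

lemma norm_sphereMean_le [NeZero k] {f : Eucl k → ℂ} {s : ℝ} (hs : 0 ≤ s) {B : ℝ}
    (h : ∀ x, ‖x‖ ^ 2 = s → ‖f x‖ ≤ B) : ‖sphereMean k f s‖ ≤ B := by
  refine (norm_integral_le_of_norm_le_const (C := B)
    (Eventually.of_forall fun u => h _ (norm_sphere_smul hs u))).trans ?_
  simp

lemma integrable_sphereProb [NeZero k] {f : Metric.sphere (0 : Eucl k) 1 → ℂ} (hf : Continuous f) :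
    Integrable f (sphereProb k) :=
  have : CompactSpace (Metric.sphere (0 : Eucl k) 1) :=
    isCompact_iff_compactSpace.1 (isCompact_sphere _ _)
  hf.integrable_of_hasCompactSupport (HasCompactSupport.of_compactSpace f)

/-! ### Comparing coefficients with and without volumes -/

lemma IsAdmissible.mul_of_bound {lam : ℕ → ℝ} {c : ℕ → ℂ} (h : IsAdmissible lam c) {d : ℕ → ℂ}
    {K : ℝ} {p : ℕ} (hd : ∀ m, ‖d m‖ ≤ K * (1 + lam m) ^ p) :
    IsAdmissible lam fun m => c m * d m := by
  obtain ⟨C, N, hC⟩ := h.polyGrowth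
  refine ⟨h.nonneg, h.locallyFinite, C * |K|, N + p, fun R hR s hs => ?_⟩
  calc ∑ m ∈ s, ‖c m * d m‖ ≤ ∑ m ∈ s, ‖c m‖ * (|K| * (1 + R) ^ p) := by
        refine Finset.sum_le_sum fun m hm => ?_
        rw [norm_mul]
        have h0 := h.nonneg m
        gcongr
        refine (hd m).trans ?_
        gcongr
        · exact le_abs_self _
        · exact hs m hm
    _ = (∑ m ∈ s, ‖c m‖) * (|K| * (1 + R) ^ p) := by rw [Finset.sum_mul]
    _ ≤ C * (1 + R) ^ N * (|K| * (1 + R) ^ p) := by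
        gcongr
        exact hC R hR s hs
    _ = _ := by ring

lemma IsAdmissible.mul_sphereVol [NeZero k] {lam : ℕ → ℝ} {c : ℕ → ℂ} (h : IsAdmissible lam c) :
    IsAdmissible lam fun m => c m * sphereVol k (lam m) := by
  refine h.mul_of_bound (K := 1 + sphereArea k) (p := k - 1) fun m => ?_
  have hA := sphereArea_pos (k := k)
  have h1 : (1 : ℝ) ≤ (1 + lam m) ^ (k - 1) := one_le_pow₀ (by linarith [h.nonneg m])
  rw [Complex.norm_real, Real.norm_of_nonneg (sphereVol_pos (h.nonneg m)).le]
  rcases (h.nonneg m).eq_or_lt with h0 | h0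
  · rw [← h0, sphereVol_zero]
    simp [hA.le]
  · rw [sphereVol_of_pos h0, mul_comm]
    have : √(lam m) ≤ 1 + lam m := by
      rw [Real.sqrt_le_left (by linarith)]
      nlinarith
    gcongr
    linarith

/-- Volumes may tend to zero with the radius, but by local finiteness only finitely many `lam m` are
at most `1`; beyond that the volume is at least `sphereArea k`. -/
lemma IsAdmissible.div_sphereVol [NeZero k] {lam : ℕ → ℝ} {c : ℕ → ℂ} (h : IsAdmissible lam c) :
    IsAdmissible lam fun m => c m / sphereVol k (lam m) := by
  have hA := sphereArea_pos (k := k)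
  have hfin := h.locallyFinite 1
  set S := hfin.toFinset
  have hpos : ∀ m, 0 < sphereVol k (lam m) := fun m => sphereVol_pos (h.nonneg m)
  have h0 : 0 ≤ ∑ m ∈ S, (sphereVol k (lam m))⁻¹ :=
    Finset.sum_nonneg fun m _ => (inv_pos.2 (hpos m)).le
  simp_rw [div_eq_mul_inv]
  refine h.mul_of_bound (K := (sphereArea k)⁻¹ + ∑ m ∈ S, (sphereVol k (lam m))⁻¹) (p := 0)
    fun m => ?_
  rw [norm_inv, Complex.norm_real, Real.norm_of_nonneg (hpos m).le, pow_zero, mul_one]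
  by_cases hm : lam m ≤ 1
  · have := Finset.single_le_sum (f := fun m => (sphereVol k (lam m))⁻¹)
      (fun m _ => (inv_pos.2 (hpos m)).le) (hfin.mem_toFinset.2 hm)
    have h2 := inv_pos.2 hA
    linarith
  · push Not at hm
    rw [sphereVol_of_pos (one_pos.trans hm)]
    refine (inv_anti₀ hA ?_).trans (le_add_of_nonneg_right h0)
    exact le_mul_of_one_le_left hA.le (one_le_pow₀ (Real.one_le_sqrt.2 hm.le))

/-! ### Rotation invariance and polar coordinates -/

/-- The restriction of a linear isometry to the unit sphere. -/
def sphereRotate (R : Eucl k ≃ₗᵢ[ℝ] Eucl k) :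
    Metric.sphere (0 : Eucl k) 1 ≃ᵐ Metric.sphere (0 : Eucl k) 1 where
  toFun u := ⟨R u, by simp⟩
  invFun u := ⟨R.symm u, by simp⟩
  left_inv u := by simp
  right_inv u := by simp
  measurable_toFun := by
    refine Measurable.subtype_mk ?_
    fun_prop
  measurable_invFun := by
    refine Measurable.subtype_mk ?_
    fun_prop

/-- Surface measure is a multiple of the volume of the cone `(0,1) • s`, and a linear isometry
preserves volume and maps cones to cones. -/
lemma measurePreserving_sphereRotate [NeZero k] (R : Eucl k ≃ₗᵢ[ℝ] Eucl k) :
    MeasurePreserving (sphereRotate R) (sphereProb k) (sphereProb k) := by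
  refine MeasurePreserving.smul_measure ⟨(sphereRotate R).measurable, ?_⟩ _
  ext s hs
  rw [(sphereRotate R).map_apply, Measure.toSphere_apply' _ hs,
    Measure.toSphere_apply' _ ((sphereRotate R).measurable hs)]
  congr 1
  have h : Set.Ioo (0 : ℝ) 1 • ((↑) '' (sphereRotate R ⁻¹' s) : Set (Eucl k))
      = R ⁻¹' (Set.Ioo (0 : ℝ) 1 • ((↑) '' s)) := by
    ext x
    simp only [Set.mem_smul, Set.mem_image, Set.mem_preimage]
    constructor
    · rintro ⟨r, hr, _, ⟨u, hu, rfl⟩, rfl⟩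
      exact ⟨r, hr, R u, ⟨_, hu, rfl⟩, by simp⟩
    · rintro ⟨r, hr, _, ⟨u, hu, rfl⟩, h⟩
      refine ⟨r, hr, R.symm u, ⟨(sphereRotate R).symm u, by simpa using hu, rfl⟩, ?_⟩
      rw [← map_smul, h, R.symm_apply_apply]
  rw [h]
  exact R.measurePreserving.measure_preimage_equiv (f := R.toMeasurableEquiv) _

lemma sphereMean_comp_isometry [NeZero k] (R : Eucl k ≃ₗᵢ[ℝ] Eucl k) (f : Eucl k → ℂ) (s : ℝ) :
    sphereMean k (fun x => f (R x)) s = sphereMean k f s := by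
  have := (measurePreserving_sphereRotate R).integral_comp' (g := fun u => f (√s • (u : Eucl k)))
  simpa [sphereMean, sphereRotate] using this

lemma exists_isometry_apply_eq {x y : Eucl k} (h : ‖x‖ = ‖y‖) :
    ∃ R : Eucl k ≃ₗᵢ[ℝ] Eucl k, R x = y :=
  ⟨(ℝ ∙ (x - y))ᗮ.reflection, Submodule.reflection_sub h⟩

/-- Integration in polar coordinates: a function may be replaced by its spherical mean. -/
lemma integral_eq_integral_sphereMean [NeZero k] {f : Eucl k → ℂ} (hf : Integrable f) :
    ∫ x, f x = ∫ x : Eucl k, sphereMean k f (‖x‖ ^ 2) := by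
  have hpolar : ∀ h : Eucl k → ℂ, ∫ x, h x = ∫ p : Metric.sphere (0 : Eucl k) 1 × Set.Ioi (0 : ℝ),
      h ((p.2 : ℝ) • (p.1 : Eucl k)) ∂(volume : Measure (Eucl k)).toSphere.prod
        (.volumeIoiPow (Module.finrank ℝ (Eucl k) - 1)) := by
    intro h
    calc ∫ x, h x = ∫ x : ({(0)}ᶜ : Set (Eucl k)), h x ∂(volume.comap Subtype.val) := by
          rw [integral_subtype_comap (measurableSet_singleton _).compl fun x ↦ h x,
            restrict_compl_singleton]
      _ = _ := by
          rw [← (volume : Measure (Eucl k)).measurePreserving_homeomorphUnitSphereProd.integral_comp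
            (Homeomorph.measurableEmbedding _)]
          refine integral_congr_ae (Eventually.of_forall fun x => ?_)
          have : ‖(x : Eucl k)‖ ≠ 0 := norm_ne_zero_iff.2 x.2
          simp [smul_smul, this]
  have hint : Integrable (fun p : Metric.sphere (0 : Eucl k) 1 × Set.Ioi (0 : ℝ) =>
      f ((p.2 : ℝ) • (p.1 : Eucl k))) ((volume : Measure (Eucl k)).toSphere.prod
        (.volumeIoiPow (Module.finrank ℝ (Eucl k) - 1))) := by
    rw [← (volume : Measure (Eucl k)).measurePreserving_homeomorphUnitSphereProd.integrable_comp_emb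
      (Homeomorph.measurableEmbedding _)]
    have h1 : Integrable (fun x : ({(0)}ᶜ : Set (Eucl k)) => f x) (volume.comap Subtype.val) := by
      have := (integrableOn_iff_comap_subtypeVal (μ := (volume : Measure (Eucl k))) (f := f)
        (measurableSet_singleton (0 : Eucl k)).compl).1 hf.integrableOn
      exact this
    refine h1.congr (Eventually.of_forall fun x => ?_)
    have : ‖(x : Eucl k)‖ ≠ 0 := norm_ne_zero_iff.2 x.2
    simp [smul_smul, this]
  rw [hpolar, hpolar, integral_prod_symm _ hint]
  have h2 : ∀ p : Metric.sphere (0 : Eucl k) 1 × Set.Ioi (0 : ℝ),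
      sphereMean k f (‖(p.2 : ℝ) • (p.1 : Eucl k)‖ ^ 2) = sphereMean k f ((p.2 : ℝ) ^ 2) := by
    rintro ⟨u, r, hr⟩
    have hr' : 0 < r := hr
    simp [norm_smul, abs_of_pos hr']
  simp_rw [h2]
  -- The right integrand depends on the radius alone, so the sphere integrates to `sphereArea k`,
  -- the same factor that `integral_toSphere` produces on the left.
  rw [integral_fun_snd (fun r : Set.Ioi (0 : ℝ) => sphereMean k f ((r : ℝ) ^ 2)),
    ← integral_smul]
  refine integral_congr_ae (Eventually.of_forall fun r => ?_)
  have hr : 0 < (r : ℝ) := r.2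
  simp only [integral_toSphere, sphereMean, Real.sqrt_sq hr.le, Complex.real_smul]
  rfl

end

/-! ## Fourier transforms of Gaussians -/

lemma gaussian_apply (k : ℕ) (τ : ℍ) (x : Eucl k) : gaussian k τ x = expo (‖x‖ ^ 2) τ := rfl

lemma coe_negInv (τ : ℍ) : (negInv τ : ℂ) = -(τ : ℂ)⁻¹ := by
  rw [negInv, ← inv_neg]

lemma re_neg_I_mul (τ : ℍ) : (-Complex.I * τ).re = τ.im := by simp

lemma sqrtNegI_ne_zero (τ : ℍ) : sqrtNegI τ ≠ 0 := by
  simp [sqrtNegI, Complex.cpow_eq_zero_iff, τ.ne_zero]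

lemma sqrtNegI_sq (τ : ℍ) : sqrtNegI τ ^ 2 = -Complex.I * τ := by
  rw [sqrtNegI, ← Complex.cpow_nat_mul]
  simp

lemma continuous_sqrtNegI : Continuous sqrtNegI := by
  refine Continuous.cpow (by fun_prop) continuous_const fun τ => Or.inl ?_
  rw [re_neg_I_mul]
  exact τ.im_pos

lemma fourier_gaussian (k : ℕ) (τ : ℍ) :
    𝓕 (gaussian k τ) = (sqrtNegI τ ^ k)⁻¹ • gaussian k (negInv τ) := by
  ext x
  have hpi : (Real.pi : ℂ) ≠ 0 := mod_cast Real.pi_ne_zero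
  have hτ : (τ : ℂ) ≠ 0 := τ.ne_zero
  set b : ℂ := -Real.pi * Complex.I * τ with hb
  have hbre : 0 < b.re := by
    simp only [hb]
    have : (-Real.pi * Complex.I * τ : ℂ).re = Real.pi * τ.im := by simp
    rw [this]
    exact mul_pos Real.pi_pos τ.im_pos
  have h1 : (gaussian k τ : Eucl k → ℂ) = fun v => Complex.exp (-b * ‖v‖ ^ 2) := by
    funext v
    rw [gaussian_apply, expo, hb]
    congr 1
    push_cast
    ring
  rw [SchwartzMap.fourier_coe, h1, fourier_gaussian_innerProductSpace hbre]
  have h2 : (Real.pi / b : ℂ) = (-Complex.I * τ)⁻¹ := by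
    rw [hb]
    field_simp
  -- Since `-iτ` lies in the right half plane, inversion commutes with the principal power.
  have harg : (-Complex.I * (τ : ℂ)).arg ≠ Real.pi := by
    intro h
    have := Complex.arg_eq_pi_iff.1 h
    rw [re_neg_I_mul] at this
    exact absurd this.1 (not_lt.2 τ.im_pos.le)
  have h3 : ((Real.pi / b : ℂ)) ^ (Module.finrank ℝ (Eucl k) / 2 : ℂ) = (sqrtNegI τ ^ k)⁻¹ := by
    rw [h2, Complex.inv_cpow _ _ harg, sqrtNegI, ← Complex.cpow_nat_mul]
    congr 2
    simp
    ring
  rw [h3]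
  change _ = (sqrtNegI τ ^ k)⁻¹ * gaussian k (negInv τ) x
  rw [gaussian_apply, expo, coe_negInv, hb]
  congr 2
  push_cast
  field_simp
  rw [Complex.I_sq]
  ring

lemma fourierInv_gaussian (k : ℕ) (τ : ℍ) :
    𝓕⁻ (gaussian k τ) = (sqrtNegI τ ^ k)⁻¹ • gaussian k (negInv τ) := by
  rw [← fourier_gaussian]
  ext x
  rw [SchwartzMap.fourierInv_coe, Real.fourierInv_eq_fourier_neg, ← SchwartzMap.fourier_coe,
    fourier_gaussian]
  change (sqrtNegI τ ^ k)⁻¹ * gaussian k (negInv τ) (-x)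
    = (sqrtNegI τ ^ k)⁻¹ * gaussian k (negInv τ) x
  rw [gaussian_apply, gaussian_apply, norm_neg]

/-- `θ` turns the Fourier transform into `f ↦ f̃`. -/
lemma theta_fourier {k : ℕ} (μ : 𝓢'(Eucl k, ℂ)) : theta (𝓕 μ) = tilde k (theta μ) := by
  funext τ
  change μ (𝓕 (gaussian k τ)) = (sqrtNegI τ ^ k)⁻¹ * μ (gaussian k (negInv τ))
  rw [fourier_gaussian, map_smul, smul_eq_mul]

/-! ## The Weil representation on Gaussians -/

lemma chirp_gaussian (k : ℕ) (b : ℝ) (τ : ℍ) :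
    chirp k b (gaussian k τ) = gaussian k (b +ᵥ τ) := by
  ext x
  rw [chirp_apply, gaussian_apply, gaussian_apply, expo, expo, ← Complex.exp_add]
  congr 1
  rw [UpperHalfPlane.coe_vadd]
  push_cast
  ring

lemma expo_eq {r s : ℝ} {τ τ' : ℍ} (h : (r : ℂ) * τ = s * τ') : expo r τ = expo s τ' := by
  rw [expo, expo, h]

lemma dilate_gaussian (k : ℕ) (u : ℝˣ) {τ τ' : ℍ} (h : (τ' : ℂ) = (u : ℝ) ^ 2 * τ) :
    dilate k u (gaussian k τ) = gaussian k τ' := by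
  ext x
  rw [dilate_apply, gaussian_apply, gaussian_apply]
  refine expo_eq ?_
  rw [h, norm_smul, mul_pow, Real.norm_eq_abs, sq_abs]
  push_cast
  ring

/-- Holomorphic square roots on the upper half plane that agree at a point are equal. -/
lemma eq_of_sq_eq {f g : ℍ → ℂ} (hf : Continuous f) (hg : Continuous g)
    (hsq : ∀ τ, f τ ^ 2 = g τ ^ 2) (hg0 : ∀ τ, g τ ≠ 0) {τ₀ : ℍ} (h0 : f τ₀ = g τ₀) : f = g := by
  funext τ
  exact isPreconnected_univ.eq_of_sq_eq hf.continuousOn hg.continuousOn (fun τ _ => hsq τ)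
    (fun {τ} _ => hg0 τ) (Set.mem_univ τ₀) h0 (Set.mem_univ τ)

lemma Mp2.coe_inv_smul (g : Mp2) (τ : ℍ) : ((g.mat⁻¹ • τ : ℍ) : ℂ) =
    ((g.mat 1 1 : ℂ) * τ - (g.mat 0 1 : ℂ)) / (-(g.mat 1 0 : ℂ) * τ + (g.mat 0 0 : ℂ)) := by
  rw [UpperHalfPlane.coe_specialLinearGroup_apply, Matrix.SpecialLinearGroup.SL2_inv_expl]
  simp [sub_eq_add_neg]

lemma Mp2.det_eq (g : Mp2) : (g.mat 0 0 : ℂ) * g.mat 1 1 - g.mat 0 1 * g.mat 1 0 = 1 := by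
  have h := g.mat.det_coe
  rw [Matrix.det_fin_two] at h
  exact_mod_cast h

lemma continuous_negInv : Continuous negInv := by
  rw [UpperHalfPlane.isEmbedding_coe.continuous_iff]
  have : (fun τ : ℍ => (τ : ℂ)) ∘ negInv = fun τ : ℍ => -(τ : ℂ)⁻¹ := funext coe_negInv
  rw [this]
  exact (UpperHalfPlane.continuous_coe.inv₀ fun τ => τ.ne_zero).neg

lemma sqrtNegI_I : sqrtNegI UpperHalfPlane.I = 1 := by
  simp [sqrtNegI]

/-- From `c P(w) + d = -1/(cw)`, the square of the left side is the constant `i/c`; by continuity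
the left side is itself constant. Its value at `w = i`, where `P(i) = -d/c + i/c²`, is the
normalizing factor in `weil`. -/
lemma Mp2.phi_mul_sqrtNegI (g : Mp2) (hc : g.mat 1 0 ≠ 0) {P : ℍ → ℍ}
    (h : ∀ w, (P w : ℂ) = -(g.mat 1 1 / g.mat 1 0 : ℝ) - ((g.mat 1 0 : ℂ) ^ 2 * w)⁻¹) (w : ℍ) :
    g.phi (P w) * sqrtNegI w = g.phi (basePoint (g.mat 1 0) (g.mat 1 1) hc) := by
  have hc' : (g.mat 1 0 : ℂ) ≠ 0 := mod_cast hc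
  have hP : Continuous P := by
    rw [UpperHalfPlane.isEmbedding_coe.continuous_iff,
      show (fun τ : ℍ => (τ : ℂ)) ∘ P = _ from funext h]
    refine continuous_const.sub ((continuous_const.mul UpperHalfPlane.continuous_coe).inv₀ ?_)
    exact fun τ => mul_ne_zero (pow_ne_zero _ hc') τ.ne_zero
  have hb : P UpperHalfPlane.I = basePoint (g.mat 1 0) (g.mat 1 1) hc := by
    ext
    rw [h]
    change _ = (((-(g.mat 1 1 / g.mat 1 0) : ℝ) : ℂ) + ((1 / g.mat 1 0 ^ 2 : ℝ) : ℂ) * Complex.I)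
    rw [UpperHalfPlane.coe_I, mul_inv, Complex.inv_I]
    push_cast
    ring
  have hsq : ∀ w, (g.phi (P w) * sqrtNegI w) ^ 2 = Complex.I / g.mat 1 0 := fun w => by
    have hw : (w : ℂ) ≠ 0 := w.ne_zero
    rw [mul_pow, g.sq, sqrtNegI_sq, h]
    push_cast
    field_simp
    ring
  have h1 := eq_of_sq_eq ((g.mdiff.continuous.comp hP).mul continuous_sqrtNegI) continuous_const
    (g := fun _ => g.phi (basePoint (g.mat 1 0) (g.mat 1 1) hc)) (fun w => ?_)
    (fun _ => g.phi_ne_zero _) (τ₀ := UpperHalfPlane.I) (by simp [sqrtNegI_I, hb])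
  · exact congrFun h1 w
  · rw [← hb]
    have := hsq UpperHalfPlane.I
    rw [sqrtNegI_I, mul_one] at this
    rw [this]
    exact hsq w

/-- On Gaussians, chirps translate `τ`, dilations scale it, and the Fourier transform inverts it, so
the composite realizes a decomposition of `g⁻¹` into such maps. This is `τ ↦ d²τ - bd` if `c = 0`,
and `τ ↦ -d/c - 1/(c²(τ - a/c))` otherwise. -/
lemma weil_gaussian (k : ℕ) (g : Mp2) (τ : ℍ) :
    weil k g (gaussian k τ) = g.phi (g.mat⁻¹ • τ) ^ k • gaussian k (g.mat⁻¹ • τ) := by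
  have hphi : Continuous g.phi := g.mdiff.continuous
  have hdet := g.det_eq
  by_cases hc : g.mat 1 0 = 0
  · have hd : (g.mat 1 1 : ℂ) ≠ 0 := mod_cast d_ne_zero g.mat hc
    have hconst : g.phi = fun _ => g.phi UpperHalfPlane.I :=
      eq_of_sq_eq hphi continuous_const (fun τ => by simp [g.sq, hc]) (fun _ => g.phi_ne_zero _)
        (τ₀ := UpperHalfPlane.I) rfl
    have hpos : 0 < ((g.mat 1 1 : ℝ) ^ 2) := by
      have := d_ne_zero g.mat hc
      positivity
    rw [weil, dif_pos hc, hconst]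
    simp only [smul_apply, ContinuousLinearMap.comp_apply]
    rw [dilate_gaussian k _ (τ' := (⟨_, hpos⟩ : {x : ℝ // 0 < x}) • τ)
      (by simp [UpperHalfPlane.coe_pos_real_smul]), chirp_gaussian]
    congr 2
    ext
    rw [UpperHalfPlane.coe_vadd, UpperHalfPlane.coe_pos_real_smul, g.coe_inv_smul, hc]
    rw [hc] at hdet
    have ha : (g.mat 0 0 : ℂ) ≠ 0 := by
      intro h
      simp [h] at hdet
    simp only [Complex.ofReal_zero, mul_zero, sub_zero] at hdet
    rw [eq_div_iff (by simpa using ha)]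
    simp only [Complex.real_smul]
    push_cast
    linear_combination (g.mat 1 1 * τ - g.mat 0 1) * hdet
  · have hc' : (g.mat 1 0 : ℂ) ≠ 0 := mod_cast hc
    have hpos : 0 < ((g.mat 1 0 : ℝ)⁻¹ ^ 2) := by positivity
    set P : ℍ → ℍ := fun w => (-(g.mat 1 1 / g.mat 1 0) : ℝ) +ᵥ
      ((⟨_, hpos⟩ : {x : ℝ // 0 < x}) • negInv w) with hPdef
    have hPc : ∀ w, (P w : ℂ) = -(g.mat 1 1 / g.mat 1 0 : ℝ) - ((g.mat 1 0 : ℂ) ^ 2 * w)⁻¹ := by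
      intro w
      rw [hPdef, UpperHalfPlane.coe_vadd, UpperHalfPlane.coe_pos_real_smul, coe_negInv]
      simp only [Complex.real_smul]
      push_cast
      rw [mul_inv, inv_pow]
      ring
    set w : ℍ := (-(g.mat 0 0 / g.mat 1 0) : ℝ) +ᵥ τ with hw
    have hwc : (w : ℂ) = τ - g.mat 0 0 / g.mat 1 0 := by
      rw [hw, UpperHalfPlane.coe_vadd]
      push_cast
      ring
    have hPw : P w = g.mat⁻¹ • τ := by
      ext
      rw [hPc, g.coe_inv_smul]
      have hw0 : (w : ℂ) ≠ 0 := w.ne_zero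
      have h1 : (-(g.mat 1 0 : ℂ) * τ + (g.mat 0 0 : ℂ)) = -(g.mat 1 0 : ℂ) * w := by
        rw [hwc]
        field_simp
        ring
      have h2 : (τ : ℂ) = w + g.mat 0 0 / g.mat 1 0 := by rw [hwc]; ring
      rw [h1, h2]
      push_cast
      field_simp
      linear_combination hdet
    rw [weil, dif_neg hc]
    simp only [smul_apply, ContinuousLinearMap.comp_apply]
    rw [chirp_gaussian, ← hw]
    change g.phi _ ^ k • chirp k _ (dilate k _ (𝓕⁻ (gaussian k w))) = _
    rw [fourierInv_gaussian, map_smul, map_smul,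
      dilate_gaussian k _ (τ' := (⟨_, hpos⟩ : {x : ℝ // 0 < x}) • negInv w)
      (by simp [UpperHalfPlane.coe_pos_real_smul]), chirp_gaussian]
    change g.phi _ ^ k • (sqrtNegI w ^ k)⁻¹ • gaussian k (P w) = _
    rw [hPw, smul_smul, ← g.phi_mul_sqrtNegI hc hPc w, hPw, mul_pow,
      mul_inv_cancel_right₀ (pow_ne_zero _ (sqrtNegI_ne_zero w))]

theorem theta_distSlash {k : ℕ} (μ : 𝓢'(Eucl k, ℂ)) (g : Mp2) :
    theta (distSlash μ g) = slash k (theta μ) g := by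
  funext τ
  rw [theta, distSlash_apply, weil_gaussian, map_smul, slash, Mp2.inv_mat, inv_inv, Mp2.inv_phi,
    inv_smul_smul, inv_pow, smul_eq_mul]
  rfl

/-! ## The theta map on spherical series -/

section

variable {k : ℕ} [NeZero k]

lemma sphereMean_gaussian (τ : ℍ) {s : ℝ} (hs : 0 ≤ s) :
    sphereMean k (gaussian k τ) s = expo s τ := by
  rw [sphereMean_congr hs (g := fun _ => expo s τ) fun x hx => by rw [gaussian_apply, hx],
    sphereMean_const]

lemma hasSum_sphereDist_iff {lam : ℕ → ℝ} (h0 : ∀ m, 0 ≤ lam m) {c : ℕ → ℂ}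
    {μ : 𝓢'(Eucl k, ℂ)} : HasSum (fun m => c m • sphereDist k (lam m)) μ ↔
      ∀ φ : 𝓢(Eucl k, ℂ), HasSum
        (fun m => c m * sphereVol k (lam m) * sphereMean k φ (lam m)) (μ φ) := by
  rw [hasSum_temperedDistribution_iff]
  refine forall_congr' fun φ => ?_
  have : (fun m => (c m • sphereDist k (lam m)) φ)
      = fun m => c m * sphereVol k (lam m) * sphereMean k φ (lam m) := by
    funext m
    change c m * sphereDist k (lam m) φ = _
    rw [sphereDist_apply φ (h0 m), mul_assoc]
  rw [this]

lemma hasSum_theta {lam : ℕ → ℝ} (h0 : ∀ m, 0 ≤ lam m) {c : ℕ → ℂ} {μ : 𝓢'(Eucl k, ℂ)}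
    (hμ : HasSum (fun m => c m • sphereDist k (lam m)) μ) (τ : ℍ) :
    HasSum (fun m => c m * sphereVol k (lam m) * expo (lam m) τ) (theta μ τ) := by
  have := (hasSum_sphereDist_iff h0).1 hμ (gaussian k τ)
  simp only [sphereMean_gaussian τ (h0 _)] at this
  exact this

/-- A spherical series with vanishing theta function is zero. -/
lemma eq_zero_of_theta_eq_zero {μ : 𝓢'(Eucl k, ℂ)} (hμ : μ ∈ seriesSpace (sphereDist k))
    (h : theta μ = 0) : μ = 0 := by
  obtain ⟨lam, c, hadm, hs⟩ := hμ
  refine ContinuousLinearMap.ext fun φ => ?_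
  refine (hadm.mul_sphereVol (k := k)).hasSum_eq_zero (fun τ => ?_)
    ((hasSum_sphereDist_iff hadm.nonneg).1 hs φ)
  have := hasSum_theta hadm.nonneg hs τ
  rwa [h] at this

/-- The theta map as a linear map. -/
def thetaLin (k : ℕ) : 𝓢'(Eucl k, ℂ) →ₗ[ℂ] (ℍ → ℂ) where
  toFun := theta
  map_add' _ _ := rfl
  map_smul' _ _ := rfl

/-- No condition on the Fourier transforms is imposed, so this applies to `𝓕 μ` and to a series not
yet known to lie in `Meas k`. -/
lemma theta_injOn {μ ν : 𝓢'(Eucl k, ℂ)} (hμ : μ ∈ seriesSpace (sphereDist k))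
    (hν : ν ∈ seriesSpace (sphereDist k)) (h : theta μ = theta ν) : μ = ν := by
  refine sub_eq_zero.1 (eq_zero_of_theta_eq_zero (Submodule.sub_mem _ hμ hν) ?_)
  rw [← sub_eq_zero.2 h]
  exact (thetaLin k).map_sub μ ν

lemma theta_mem_seriesSpace {μ : 𝓢'(Eucl k, ℂ)} (hμ : μ ∈ seriesSpace (sphereDist k)) :
    theta μ ∈ seriesSpace expo := by
  obtain ⟨lam, c, hadm, hs⟩ := hμ
  exact ⟨lam, _, hadm.mul_sphereVol,
    hasSum_seriesSpace_expo_iff.2 (hasSum_theta hadm.nonneg hs)⟩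

lemma mem_holo_of_mem_seriesSpace {f : ℍ → ℂ} (hf : f ∈ seriesSpace expo) : f ∈ holo := by
  obtain ⟨lam, c, hadm, hs⟩ := hf
  exact hadm.mdiff (hasSum_seriesSpace_expo_iff.1 hs)

lemma theta_mem_FS {μ : 𝓢'(Eucl k, ℂ)} (hμ : μ ∈ Meas k) : theta μ ∈ FS k := by
  have h1 := theta_mem_seriesSpace hμ.1
  have h2 : tilde k (theta μ) ∈ seriesSpace expo := by
    rw [← theta_fourier]
    exact theta_mem_seriesSpace hμ.2
  exact ⟨⟨mem_holo_of_mem_seriesSpace h1, h1⟩, h2⟩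

theorem fourier_eq_self_iff {μ : 𝓢'(Eucl k, ℂ)} (hμ : μ ∈ Meas k) :
    𝓕 μ = μ ↔ ∀ τ : ℍ, theta μ (negInv τ) = sqrtNegI τ ^ k * theta μ τ := by
  have h1 : 𝓕 μ = μ ↔ theta (𝓕 μ) = theta μ :=
    ⟨fun h => by rw [h], fun h => theta_injOn hμ.2 hμ.1 h⟩
  rw [h1, theta_fourier, funext_iff]
  refine forall_congr' fun τ => ?_
  exact inv_mul_eq_iff_eq_mul₀ (pow_ne_zero _ (sqrtNegI_ne_zero τ))

/-! ## Existence of the spherical series -/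

/-- On `‖x‖² = s` one has `1 + s ≤ (1 + ‖x‖)²`, so `N` powers of decay in `s` cost `2N` powers of
`‖x‖`. -/
lemma norm_sphereMean_schwartz_le (φ : 𝓢(Eucl k, ℂ)) (N : ℕ) {s : ℝ} (hs : 0 ≤ s) :
    ‖sphereMean k φ s‖ ≤ (1 + s)⁻¹ ^ N * (2 ^ (2 * N) *
      ((Finset.Iic (2 * N, 0)).sup (schwartzSeminormFamily ℂ (Eucl k) ℂ)) φ) := by
  refine norm_sphereMean_le hs fun x hx => ?_
  have h := SchwartzMap.one_add_le_sup_seminorm_apply (𝕜 := ℂ) (m := (2 * N, 0)) le_rfl le_rfl φ x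
  rw [norm_iteratedFDeriv_zero, pow_mul] at h
  rw [inv_pow, ← div_eq_inv_mul, le_div_iff₀ (by positivity), mul_comm]
  refine le_trans ?_ h
  gcongr
  rw [← hx]
  nlinarith [norm_nonneg x]

/-- The tempered distribution `∑ c_m δ_{S_{lam_m}} / vol(S_{lam_m})`. -/
lemma IsAdmissible.exists_hasSum_sphereMean {lam : ℕ → ℝ} {c : ℕ → ℂ} (h : IsAdmissible lam c) :
    ∃ μ : 𝓢'(Eucl k, ℂ), ∀ φ : 𝓢(Eucl k, ℂ),
      HasSum (fun m => c m * sphereMean k φ (lam m)) (μ φ) := by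
  obtain ⟨N, hN⟩ := h.exists_summable_div_pow
  set p := (Finset.Iic (2 * N, 0)).sup (schwartzSeminormFamily ℂ (Eucl k) ℂ)
  have hle : ∀ (φ : 𝓢(Eucl k, ℂ)) m, ‖c m * sphereMean k φ (lam m)‖
      ≤ ‖c m‖ / (1 + lam m) ^ N * (2 ^ (2 * N) * p φ) := fun φ m => by
    rw [norm_mul, div_mul_eq_mul_div, mul_div_assoc, div_eq_inv_mul, ← inv_pow]
    gcongr
    exact norm_sphereMean_schwartz_le φ N (h.nonneg m)
  have hsum : ∀ φ : 𝓢(Eucl k, ℂ), Summable fun m => c m * sphereMean k φ (lam m) := fun φ =>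
    (hN.mul_right _).of_norm_bounded (hle φ)
  let T : 𝓢(Eucl k, ℂ) →L[ℂ] ℂ := SchwartzMap.mkCLMtoNormedSpace
    (fun φ => ∑' m, c m * sphereMean k φ (lam m))
    (fun φ ψ => by
      rw [← (hsum φ).tsum_add (hsum ψ)]
      refine tsum_congr fun m => ?_
      rw [← mul_add]
      congr 1
      exact integral_add (integrable_sphereProb (by fun_prop)) (integrable_sphereProb (by fun_prop)))
    (fun a φ => by
      rw [RingHom.id_apply, smul_eq_mul, ← tsum_mul_left]
      refine tsum_congr fun m => ?_
      rw [mul_left_comm]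
      congr 1
      exact integral_const_mul a _)
    ⟨Finset.Iic (2 * N, 0), (∑' m, ‖c m‖ / (1 + lam m) ^ N) * 2 ^ (2 * N),
      mul_nonneg (tsum_nonneg fun m => div_nonneg (norm_nonneg _)
        (pow_nonneg (by linarith [h.nonneg m]) _)) (by positivity), fun φ => by
      rw [mul_assoc, ← tsum_mul_right]
      exact tsum_of_norm_bounded (hN.mul_right _).hasSum (hle φ)⟩
  exact ⟨ContinuousLinearMap.toPointwiseConvergenceCLM _ _ _ _ T, fun φ => (hsum φ).hasSum⟩

lemma IsAdmissible.hasSum_div_sphereVol {lam : ℕ → ℝ} {c : ℕ → ℂ} (h : IsAdmissible lam c)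
    {μ : 𝓢'(Eucl k, ℂ)}
    (hμ : ∀ φ : 𝓢(Eucl k, ℂ), HasSum (fun m => c m * sphereMean k φ (lam m)) (μ φ)) :
    HasSum (fun m => (c m / sphereVol k (lam m)) • sphereDist k (lam m)) μ := by
  refine (hasSum_sphereDist_iff h.nonneg).2 fun φ => ?_
  convert hμ φ using 3 with m
  exact div_mul_cancel₀ _ (mod_cast (sphereVol_pos (h.nonneg m)).ne')

end

/-! ## Density of compactly supported Schwartz functions -/

section Density

variable {E : Type*} [NormedAddCommGroup E] [NormedSpace ℝ E] [FiniteDimensional ℝ E]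
  [HasContDiffBump E]

/-- A smooth function that vanishes near the origin and is `1` outside a compact set has
derivatives of at most linear growth. -/
lemma exists_norm_iteratedFDeriv_one_sub_bump_le (b : ContDiffBump (0 : E)) (hb : b.rIn = 1)
    (i : ℕ) : ∃ C : ℝ, 0 ≤ C ∧
      ∀ y, ‖iteratedFDeriv ℝ i (fun x => 1 - b x) y‖ ≤ C * ‖y‖ := by
  obtain ⟨C, hC⟩ := (b.hasCompactSupport.iteratedFDeriv (𝕜 := ℝ) i).exists_bound_of_continuous
    ((b.contDiff (n := i)).continuous_iteratedFDeriv le_rfl)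
  have hC0 : 0 ≤ C := (norm_nonneg _).trans (hC 0)
  refine ⟨1 + C, by positivity, fun y => ?_⟩
  rcases lt_or_ge ‖y‖ 1 with hy | hy
  · have h0 : (fun x => 1 - b x) =ᶠ[𝓝 y] fun _ => (0 : ℝ) := by
      filter_upwards [Metric.isOpen_ball.mem_nhds (mem_ball_zero_iff.2 hy)] with x hx
      rw [b.one_of_mem_closedBall (by rw [hb]; exact Metric.ball_subset_closedBall hx), sub_self]
    rw [(h0.iteratedFDeriv ℝ i).eq_of_nhds]
    have : iteratedFDeriv ℝ i (fun _ : E => (0 : ℝ)) y = 0 := by simp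
    rw [this, norm_zero]
    positivity
  · have h1 : ‖iteratedFDeriv ℝ i (fun _ : E => (1 : ℝ)) y‖ ≤ 1 := by
      rcases eq_or_ne i 0 with rfl | hi
      · simp
      · simp [iteratedFDeriv_const_of_ne hi]
    have h2 : iteratedFDeriv ℝ i (fun x => 1 - b x) y
        = iteratedFDeriv ℝ i (fun _ : E => (1 : ℝ)) y - iteratedFDeriv ℝ i b y :=
      iteratedFDeriv_sub_apply contDiffAt_const (b.contDiffAt (n := i))
    rw [h2]
    calc _ ≤ 1 + C := (norm_sub_le _ _).trans (add_le_add h1 (hC y))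
      _ ≤ (1 + C) * ‖y‖ := le_mul_of_one_le_right (by positivity) hy

/-- Cut off with `b(r x)`, `r → 0`. Derivatives of `1 - b(r x)` are at most `C r ‖x‖`; the gained
`r` gives convergence and the extra `‖x‖` is absorbed by the next seminorm. -/
lemma dense_hasCompactSupport : Dense {ψ : 𝓢(E, ℂ) | HasCompactSupport ψ} := by
  intro φ
  let b : ContDiffBump (0 : E) := ⟨1, 2, one_pos, one_lt_two⟩
  let r : ℕ → ℝ := fun n => ((n : ℝ) + 1)⁻¹
  have hr : ∀ n, 0 < r n := fun n => by positivity
  have hsupp : ∀ n, HasCompactSupport fun x => b (r n • x) := fun n =>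
    b.hasCompactSupport.comp_homeomorph (Homeomorph.smulOfNeZero (r n) (hr n).ne')
  have hbs : ∀ n, ContDiff ℝ ∞ fun x => b (r n • x) := fun n =>
    b.contDiff.comp (contDiff_const_smul (r n))
  let ψ : ℕ → 𝓢(E, ℂ) := fun n => HasCompactSupport.toSchwartzMap
    (f := fun x => b (r n • x) • φ x) (hsupp n).smul_right ((hbs n).smul (φ.smooth ⊤))
  have hψ : ∀ n x, (φ - ψ n) x = (1 - b (r n • x)) • φ x := fun n x => by
    change φ x - b (r n • x) • φ x = _
    rw [sub_smul, one_smul]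
  choose C hC0 hC using exists_norm_iteratedFDeriv_one_sub_bump_le b rfl
  refine mem_closure_of_tendsto (f := ψ) (b := atTop) ?_
    (Eventually.of_forall fun n => (hsupp n).smul_right)
  refine ((schwartz_withSeminorms ℂ E ℂ).tendsto_nhds ψ φ).2 fun ⟨p, j⟩ ε hε => ?_
  set K : ℝ := ∑ i ∈ Finset.range (j + 1), (j.choose i : ℝ) * C i *
    SchwartzMap.seminorm ℂ (p + 1) (j - i) φ
  have hK : ∀ n, SchwartzMap.seminorm ℂ p j (φ - ψ n) ≤ r n * K := fun n => by
    refine SchwartzMap.seminorm_le_bound _ _ _ _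
      (mul_nonneg (hr n).le (Finset.sum_nonneg fun i _ => mul_nonneg
        (mul_nonneg (by positivity) (hC0 i)) (apply_nonneg _ _))) fun x => ?_
    rw [show ((φ - ψ n : 𝓢(E, ℂ)) : E → ℂ) = fun x => (1 - b (r n • x)) • φ x from
      funext (hψ n)]
    have h1 := norm_iteratedFDeriv_smul_le (𝕜 := ℝ) (n := j) (N := ∞)
      (f := fun x => 1 - b (r n • x)) (contDiff_const.sub (hbs n)) (φ.smooth ⊤) x
      (mod_cast le_top)
    have h2 : ∀ i, ‖iteratedFDeriv ℝ i (fun x => 1 - b (r n • x)) x‖ ≤ C i * (r n * ‖x‖) := by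
      intro i
      rw [iteratedFDeriv_comp_const_smul (f := fun x => 1 - b x) (r n)
        (contDiff_const.sub b.contDiff)]
      simp only
      rw [norm_smul, norm_pow, Real.norm_of_nonneg (hr n).le]
      refine (mul_le_of_le_one_left (norm_nonneg _) (pow_le_one₀ (hr n).le ?_)).trans
        ((hC i _).trans_eq ?_)
      · exact inv_le_one_of_one_le₀ (by linarith [Nat.cast_nonneg (α := ℝ) n])
      · rw [norm_smul, Real.norm_of_nonneg (hr n).le]
    calc ‖x‖ ^ p * ‖iteratedFDeriv ℝ j (fun x => (1 - b (r n • x)) • φ x) x‖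
        ≤ ‖x‖ ^ p * ∑ i ∈ Finset.range (j + 1), (j.choose i : ℝ) * (C i * (r n * ‖x‖)) *
            ‖iteratedFDeriv ℝ (j - i) φ x‖ := by
          gcongr
          refine h1.trans ?_
          gcongr
          exact h2 _
      _ = r n * ∑ i ∈ Finset.range (j + 1), (j.choose i : ℝ) * C i *
            (‖x‖ ^ (p + 1) * ‖iteratedFDeriv ℝ (j - i) φ x‖) := by
          rw [Finset.mul_sum, Finset.mul_sum]
          refine Finset.sum_congr rfl fun i _ => ?_
          ring
      _ ≤ r n * K := by
          refine mul_le_mul_of_nonneg_left (Finset.sum_le_sum fun i _ => ?_) (hr n).le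
          exact mul_le_mul_of_nonneg_left (SchwartzMap.le_seminorm ℂ _ _ φ x)
            (mul_nonneg (by positivity) (hC0 i))
  have hlim : Tendsto (fun n => r n * K) atTop (𝓝 0) := by
    have := (tendsto_one_div_add_atTop_nhds_zero_nat (𝕜 := ℝ)).mul_const K
    simpa [r] using this
  filter_upwards [hlim.eventually (gt_mem_nhds hε)] with n hn
  rw [← neg_sub, map_neg_eq_map]
  exact (hK n).trans_lt hn

end Density

/-! ## The Fourier transform of a superposition of Gaussians -/

/-- The Fourier transform of the uniform probability measure on the sphere of radius `√s`. -/
def sphereKernel (k : ℕ) (s : ℝ) (x : Eucl k) : ℂ :=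
  sphereMean k (fun y => Complex.exp ((-2 * Real.pi * ⟪x, y⟫ : ℝ) * Complex.I)) s

section

variable {k : ℕ} [NeZero k]

lemma sphereKernel_isometry (s : ℝ) (R : Eucl k ≃ₗᵢ[ℝ] Eucl k) (x : Eucl k) :
    sphereKernel k s (R x) = sphereKernel k s x := by
  rw [sphereKernel, ← sphereMean_comp_isometry R]
  simp only [R.inner_map_map]
  rfl

/-- Isometries act transitively on spheres, so the isometry-invariant kernel is radial. -/
lemma sphereKernel_congr (s : ℝ) {x y : Eucl k} (h : ‖x‖ = ‖y‖) :
    sphereKernel k s x = sphereKernel k s y := by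
  obtain ⟨R, rfl⟩ := exists_isometry_apply_eq h
  exact (sphereKernel_isometry s R x).symm

lemma norm_sphereKernel_le (s : ℝ) (x : Eucl k) : ‖sphereKernel k s x‖ ≤ 1 := by
  refine (norm_integral_le_of_norm_le_const (C := 1) (Eventually.of_forall fun u => ?_)).trans
    (by simp)
  rw [Complex.norm_exp_ofReal_mul_I]

lemma continuous_sphereKernel (s : ℝ) : Continuous (sphereKernel k s) := by
  refine continuous_of_dominated (bound := fun _ => 1) (fun x => ?_)
    (fun x => Eventually.of_forall fun u => ?_) (integrable_const _)
    (Eventually.of_forall fun u => by fun_prop)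
  · exact Continuous.aestronglyMeasurable (by fun_prop)
  · rw [Complex.norm_exp_ofReal_mul_I]

lemma integrable_mul_sphereKernel (s : ℝ) {f : Eucl k → ℂ} (hf : Integrable f) :
    Integrable fun x => f x * sphereKernel k s x :=
  hf.mul_bdd (c := 1) (continuous_sphereKernel s).aestronglyMeasurable
    (Eventually.of_forall (norm_sphereKernel_le s))

lemma sphereMean_fourier (φ : 𝓢(Eucl k, ℂ)) (s : ℝ) :
    sphereMean k (𝓕 φ : 𝓢(Eucl k, ℂ)) s = ∫ x, φ x * sphereKernel k s x := by
  rw [sphereMean]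
  simp only [SchwartzMap.fourier_coe, Real.fourier_eq', sphereKernel, sphereMean]
  rw [integral_integral_swap]
  · refine integral_congr_ae (Eventually.of_forall fun x => ?_)
    simp only [smul_eq_mul]
    rw [← integral_const_mul]
    refine integral_congr_ae (Eventually.of_forall fun u => ?_)
    simp only
    rw [mul_comm]
  · refine ((φ.integrable (μ := volume)).comp_snd (sphereProb k)).mono ?_
      (Eventually.of_forall fun p => ?_)
    · exact Continuous.aestronglyMeasurable (by fun_prop)
    · simp only [Function.uncurry]
      rw [norm_smul, Complex.norm_exp_ofReal_mul_I, one_mul]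

/-- The radial kernel comes out of the average in polar coordinates. Thus the means of `φ` determine
those of its Fourier transform. -/
lemma sphereMean_fourier_eq_integral_sphereMean (φ : 𝓢(Eucl k, ℂ)) (s : ℝ) :
    sphereMean k (𝓕 φ : 𝓢(Eucl k, ℂ)) s = ∫ x : Eucl k, sphereMean k φ (‖x‖ ^ 2) * sphereKernel k s x := by
  rw [sphereMean_fourier, integral_eq_integral_sphereMean
    (integrable_mul_sphereKernel s φ.integrable)]
  refine integral_congr_ae (Eventually.of_forall fun x => ?_)
  simp only
  rw [sphereMean_congr (sq_nonneg _) (g := fun y => φ y * sphereKernel k s x) fun y hy => ?_]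
  · exact integral_mul_const _ _
  · rw [sphereKernel_congr s ((sq_eq_sq₀ (norm_nonneg _) (norm_nonneg _)).1 hy)]

lemma continuous_expo (s : ℝ) : Continuous (expo s) := by
  unfold expo
  fun_prop

/-- If the spherical means of `φ` are a superposition of Gaussians, then so are those of its
Fourier transform. -/
lemma sphereMean_fourier_of_superposition (φ : 𝓢(Eucl k, ℂ)) {ρ : Measure ℝ} [IsFiniteMeasure ρ]
    {β : ℝ → ℂ} (hβ : Continuous β) {B : ℝ} (hB : ∀ θ, ‖β θ‖ ≤ B) {T : ℝ → ℍ} (hT : Continuous T)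
    {τ₀ : ℍ} (hy : ∀ θ, τ₀.im ≤ (T θ).im)
    (h : ∀ s, 0 ≤ s → sphereMean k φ s = ∫ θ, β θ * expo s (T θ) ∂ρ) {s : ℝ} (hs : 0 ≤ s) :
    sphereMean k (𝓕 φ : 𝓢(Eucl k, ℂ)) s
      = ∫ θ, (β θ * (sqrtNegI (T θ) ^ k)⁻¹) * expo s (negInv (T θ)) ∂ρ := by
  have hB0 : 0 ≤ B := (norm_nonneg _).trans (hB 0)
  calc sphereMean k (𝓕 φ : 𝓢(Eucl k, ℂ)) s
      = ∫ x : Eucl k, (∫ θ, β θ * expo (‖x‖ ^ 2) (T θ) * sphereKernel k s x ∂ρ) := by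
        rw [sphereMean_fourier_eq_integral_sphereMean]
        refine integral_congr_ae (Eventually.of_forall fun x => ?_)
        simp only [h _ (sq_nonneg _)]
        exact (integral_mul_const _ _).symm
    _ = ∫ θ, (∫ x : Eucl k, β θ * expo (‖x‖ ^ 2) (T θ) * sphereKernel k s x) ∂ρ := by
        -- Fubini: every Gaussian occurring is dominated by the one at `τ₀`.
        refine integral_integral_swap ?_
        have hi : Integrable (fun x : Eucl k => B * ‖gaussian k τ₀ x‖) :=
          ((gaussian k τ₀).integrable (μ := volume)).norm.const_mul B
        refine (hi.comp_fst ρ).mono' ?_ (Eventually.of_forall fun p => ?_)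
        · refine Continuous.aestronglyMeasurable ?_
          have h1 : Continuous fun p : Eucl k × ℝ => expo (‖p.1‖ ^ 2) (T p.2) := by
            unfold expo
            fun_prop
          have h2 := continuous_sphereKernel (k := k) s
          simp only [Function.uncurry_def]
          fun_prop
        · simp only [Function.uncurry_def]
          rw [norm_mul, norm_mul, ← mul_one (B * _)]
          gcongr
          · exact hB _
          · rw [gaussian_apply, norm_expo _ τ₀]
            exact norm_expo_le (sq_nonneg _) (hy _)
          · exact norm_sphereKernel_le s _
    _ = _ := by
        refine integral_congr_ae (Eventually.of_forall fun θ => ?_)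
        simp only [mul_assoc]
        rw [integral_const_mul]
        congr 1
        -- For a single Gaussian the integral against the kernel is read off by applying
        -- `sphereMean_fourier` backwards to `fourier_gaussian`.
        have := sphereMean_fourier (gaussian k (T θ)) s
        rw [fourier_gaussian] at this
        rw [← sphereMean_gaussian (k := k) _ hs]
        refine this.symm.trans ?_
        exact integral_const_mul _ _

/-! ## Vanishing on superpositions of Gaussians -/

/-- The bound `y ≤ im T` gives a summable majorant uniform in `θ`, so the expansion integrates term
by term. -/
lemma IsAdmissible.hasSum_integral_expo {lam : ℕ → ℝ} {c : ℕ → ℂ} (h : IsAdmissible lam c)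
    {f : ℍ → ℂ} (hf : ∀ τ, HasSum (fun m => c m * expo (lam m) τ) (f τ))
    {ρ : Measure ℝ} [IsFiniteMeasure ρ] {γ : ℝ → ℂ} (hγ : Continuous γ) {B : ℝ}
    (hB : ∀ θ, ‖γ θ‖ ≤ B) {T : ℝ → ℍ} (hT : Continuous T) {y : ℝ} (hy0 : 0 < y)
    (hy : ∀ θ, y ≤ (T θ).im) :
    HasSum (fun m => c m * ∫ θ, γ θ * expo (lam m) (T θ) ∂ρ) (∫ θ, γ θ * f (T θ) ∂ρ) := by
  have hB0 : 0 ≤ B := (norm_nonneg _).trans (hB 0)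
  have hbd : ∀ m θ, ‖c m * (γ θ * expo (lam m) (T θ))‖
      ≤ B * (‖c m‖ * Real.exp (-(Real.pi * y * lam m))) := fun m θ => by
    rw [norm_mul, norm_mul, mul_left_comm]
    gcongr
    · exact hB θ
    · exact norm_expo_le (h.nonneg m) (hy θ)
  have hint : ∀ m, Integrable (fun θ => c m * (γ θ * expo (lam m) (T θ))) ρ := fun m =>
    Integrable.of_bound (Continuous.aestronglyMeasurable
      (continuous_const.mul (hγ.mul ((continuous_expo _).comp hT)))) _
      (Eventually.of_forall (hbd m))
  have h1 := hasSum_integral_of_summable_integral_norm hint ?_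
  · simp_rw [integral_const_mul] at h1
    have h2 : ∫ θ, γ θ * f (T θ) ∂ρ = ∫ θ, ∑' m, c m * (γ θ * expo (lam m) (T θ)) ∂ρ := ?_
    · rw [h2]
      exact h1
    refine integral_congr_ae (Eventually.of_forall fun θ => ?_)
    simp only
    rw [← ((hf (T θ)).mul_left (γ θ)).tsum_eq]
    refine tsum_congr fun m => ?_
    ring
  · refine Summable.of_nonneg_of_le (fun m => integral_nonneg fun θ => norm_nonneg _) (fun m => ?_)
      (((h.summable_exp (mul_pos Real.pi_pos hy0)).mul_left B).mul_left (ρ.real Set.univ))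
    refine (integral_mono (hint m).norm (integrable_const _) (hbd m)).trans_eq ?_
    simp

/-- Integrating the two expansions term by term gives `ν φ = ∫ β f̃(T)` and `(𝓕 μ) φ = μ (𝓕 φ) = ∫ β
√(-iT)^{-k} f(-1/T)`. Both `T` and `-1/T` must stay away from the real line. -/
lemma fourier_apply_eq_of_superposition {lam lam' : ℕ → ℝ} {c c' : ℕ → ℂ}
    (h : IsAdmissible lam c) (h' : IsAdmissible lam' c') {f : ℍ → ℂ}
    (hf : ∀ τ, HasSum (fun m => c m * expo (lam m) τ) (f τ))
    (hf' : ∀ τ, HasSum (fun m => c' m * expo (lam' m) τ) (tilde k f τ))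
    {μ ν : 𝓢'(Eucl k, ℂ)}
    (hμ : ∀ φ : 𝓢(Eucl k, ℂ), HasSum (fun m => c m * sphereMean k φ (lam m)) (μ φ))
    (hν : ∀ φ : 𝓢(Eucl k, ℂ), HasSum (fun m => c' m * sphereMean k φ (lam' m)) (ν φ))
    (φ : 𝓢(Eucl k, ℂ)) {ρ : Measure ℝ} [IsFiniteMeasure ρ]
    {β : ℝ → ℂ} (hβ : Continuous β) {B : ℝ} (hB : ∀ θ, ‖β θ‖ ≤ B) {T : ℝ → ℍ} (hT : Continuous T)
    {τ₀ : ℍ} (hy : ∀ θ, τ₀.im ≤ (T θ).im) (hy' : ∀ θ, τ₀.im ≤ (negInv (T θ)).im)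
    (hφ : ∀ s, 0 ≤ s → sphereMean k φ s = ∫ θ, β θ * expo s (T θ) ∂ρ) :
    (𝓕 μ) φ = ν φ := by
  have h1 := hν φ
  simp_rw [hφ _ (h'.nonneg _)] at h1
  have h2 := hμ (𝓕 φ)
  simp_rw [sphereMean_fourier_of_superposition φ hβ hB hT hy hφ (h.nonneg _)] at h2
  -- As `|√(-iT)|² = |T| ≥ im T`, the automorphy factor is bounded below.
  have hs : ∀ θ, τ₀.im ^ k ≤ ‖sqrtNegI (T θ) ^ k‖ ^ 2 := fun θ => by
    rw [← norm_pow, ← pow_mul, mul_comm, pow_mul, sqrtNegI_sq, norm_pow]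
    have : (T θ).im ≤ ‖-Complex.I * (T θ : ℂ)‖ := by
      rw [norm_mul, norm_neg, Complex.norm_I, one_mul]
      exact (le_abs_self _).trans (Complex.abs_im_le_norm _)
    exact pow_le_pow_left₀ τ₀.im_pos.le ((hy θ).trans this) _
  have h3 := h.hasSum_integral_expo hf (ρ := ρ)
    (γ := fun θ => β θ * (sqrtNegI (T θ) ^ k)⁻¹) (B := B * (√(τ₀.im ^ k))⁻¹)
    (hβ.mul (((continuous_sqrtNegI.comp hT).pow k).inv₀ fun θ =>
      pow_ne_zero _ (sqrtNegI_ne_zero _))) (fun θ => ?_) (continuous_negInv.comp hT) τ₀.im_pos hy'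
  · have h4 := h'.hasSum_integral_expo hf' (ρ := ρ) hβ hB hT τ₀.im_pos hy
    refine (h2.unique h3).trans (Eq.trans ?_ (h1.unique h4).symm)
    refine integral_congr_ae (Eventually.of_forall fun θ => ?_)
    exact mul_assoc _ _ _
  · have hp : 0 < √(τ₀.im ^ k) := Real.sqrt_pos.2 (pow_pos τ₀.im_pos k)
    rw [norm_mul, norm_inv]
    have hB0 : 0 ≤ B := (norm_nonneg _).trans (hB 0)
    gcongr
    · exact hB θ
    · exact Real.sqrt_le_iff.2 ⟨norm_nonneg _, hs θ⟩

end

/-! ## Entire functions as superpositions of exponentials over a circle -/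

lemma integral_exp_int_mul_I (n : ℤ) :
    ∫ θ in Set.Ioc 0 (2 * Real.pi), Complex.exp (n * (θ * Complex.I))
      = if n = 0 then (2 * Real.pi : ℂ) else 0 := by
  rw [← intervalIntegral.integral_of_le (by positivity)]
  split_ifs with h
  · simp [h]
  · have hc : (n * Complex.I : ℂ) ≠ 0 := mul_ne_zero (mod_cast h) Complex.I_ne_zero
    have := integral_exp_mul_complex (a := 0) (b := 2 * Real.pi) hc
    simp only [mul_comm _ Complex.I, ← mul_assoc] at this ⊢
    rw [this]
    have h1 : Complex.exp (Complex.I * n * (2 * Real.pi : ℝ)) = 1 := by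
      rw [← Complex.exp_int_mul_two_pi_mul_I n]
      congr 1
      push_cast
      ring
    rw [h1]
    simp

lemma norm_exp_exp_le (s θ : ℝ) :
    ‖Complex.exp (s * Complex.exp (θ * Complex.I))‖ ≤ Real.exp |s| := by
  rw [Complex.norm_exp, Real.exp_le_exp]
  refine (Complex.re_le_norm _).trans ?_
  rw [norm_mul, Complex.norm_exp_ofReal_mul_I, Complex.norm_real, mul_one, Real.norm_eq_abs]

/-- Cauchy's formula for the coefficients of the exponential function. -/
lemma integral_exp_mul_exp_exp (j : ℕ) (s : ℝ) :
    ∫ θ in Set.Ioc 0 (2 * Real.pi), Complex.exp (-j * (θ * Complex.I)) *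
      Complex.exp (s * Complex.exp (θ * Complex.I)) = 2 * Real.pi * (s ^ j / j.factorial) := by
  -- Expand the inner exponential; after integration, orthogonality of characters leaves only `n =
  -- j`.
  have hterm : ∀ (n : ℕ) (θ : ℝ), Complex.exp (-j * (θ * Complex.I)) *
      ((s * Complex.exp (θ * Complex.I)) ^ n / n.factorial)
      = s ^ n / n.factorial * Complex.exp (((n - j : ℤ) : ℂ) * (θ * Complex.I)) := by
    intro n θ
    rw [mul_pow, ← Complex.exp_nat_mul, mul_div_right_comm, mul_left_comm, ← Complex.exp_add]
    congr 2
    push_cast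
    ring
  have h1 := hasSum_integral_of_summable_integral_norm
    (μ := volume.restrict (Set.Ioc 0 (2 * Real.pi)))
    (F := fun (n : ℕ) (θ : ℝ) => Complex.exp (-j * (θ * Complex.I)) *
      ((s * Complex.exp (θ * Complex.I)) ^ n / n.factorial)) (fun n => ?_) ?_
  · have h2 : ∀ n : ℕ, ∫ θ in Set.Ioc 0 (2 * Real.pi), Complex.exp (-j * (θ * Complex.I)) *
        ((s * Complex.exp (θ * Complex.I)) ^ n / n.factorial)
        = if n = j then (2 * Real.pi * (s ^ j / j.factorial) : ℂ) else 0 := by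
      intro n
      simp_rw [hterm]
      rw [integral_const_mul, integral_exp_int_mul_I]
      by_cases hn : n = j
      · simp [hn, mul_comm]
      · have : (n : ℤ) - j ≠ 0 := by omega
        simp [hn, this]
    simp_rw [h2] at h1
    generalize (2 * Real.pi * (s ^ j / j.factorial) : ℂ) = X at h1 ⊢
    rw [← h1.unique (hasSum_ite_eq j X)]
    refine integral_congr_ae (Eventually.of_forall fun θ => ?_)
    simp only
    rw [tsum_mul_left, Complex.exp_eq_exp_ℂ, NormedSpace.exp_eq_tsum_div]
  · exact (Continuous.integrableOn_Ioc (by fun_prop))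
  · have : ∀ (n : ℕ) (θ : ℝ), ‖Complex.exp (-j * (θ * Complex.I)) *
        ((s * Complex.exp (θ * Complex.I)) ^ n / n.factorial)‖ = |s| ^ n / n.factorial := by
      intro n θ
      rw [hterm, norm_mul, norm_div, norm_pow, Complex.norm_real, Complex.norm_natCast,
        Real.norm_eq_abs]
      have : (((n - j : ℤ) : ℂ) * (θ * Complex.I)) = ((((n - j : ℤ) : ℝ) * θ : ℝ) : ℂ) * Complex.I
        := by push_cast; ring
      rw [this, Complex.norm_exp_ofReal_mul_I, mul_one]
    simp_rw [this]
    simp only [integral_const, smul_eq_mul]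
    exact (Real.summable_pow_div_factorial |s|).mul_left _

/-- An entire function `∑ b_j s^j` whose Borel transform converges at the unit circle is a
superposition of the exponentials `exp (s w)`, `|w| = 1`. -/
lemma exists_superposition {b : ℕ → ℂ} (hb : Summable fun j => ‖b j‖ * j.factorial) :
    ∃ β : ℝ → ℂ, Continuous β ∧ (∃ B, ∀ θ, ‖β θ‖ ≤ B) ∧ ∀ (s : ℝ) (a : ℂ),
      HasSum (fun j => b j * s ^ j) a →
      a = ∫ θ in Set.Ioc 0 (2 * Real.pi),
        β θ * Complex.exp (s * Complex.exp (θ * Complex.I)) := by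
  -- The density is the Borel transform on the unit circle, `β(θ) = (2π)⁻¹ ∑ b_j j! e^{-ijθ}`. The
  -- weighted summability makes it converge uniformly, and Cauchy's formula recovers `b_j s^j` from
  -- each term.
  set F : ℕ → ℝ → ℂ := fun j θ => (2 * Real.pi : ℂ)⁻¹ * (b j * j.factorial) *
    Complex.exp (-j * (θ * Complex.I)) with hF
  have hpi : (2 * Real.pi : ℂ) ≠ 0 := mod_cast Real.two_pi_pos.ne'
  have hFn : ∀ j θ, ‖F j θ‖ = ‖(2 * Real.pi : ℂ)⁻¹‖ * (‖b j‖ * j.factorial) := by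
    intro j θ
    have : (-j * (θ * Complex.I) : ℂ) = ((-j * θ : ℝ) : ℂ) * Complex.I := by push_cast; ring
    rw [hF]
    simp only
    rw [norm_mul, this, Complex.norm_exp_ofReal_mul_I, mul_one, norm_mul, norm_mul,
      Complex.norm_natCast]
  have hFs := hb.mul_left ‖(2 * Real.pi : ℂ)⁻¹‖
  have hFc : ∀ j, Continuous (F j) := fun j => by fun_prop
  refine ⟨fun θ => ∑' j, F j θ, continuous_tsum hFc hFs fun j θ => (hFn j θ).le,
    ⟨_, fun θ => tsum_of_norm_bounded hFs.hasSum fun j => (hFn j θ).le⟩, fun s a ha => ?_⟩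
  have h1 := hasSum_integral_of_summable_integral_norm
    (μ := volume.restrict (Set.Ioc 0 (2 * Real.pi)))
    (F := fun (j : ℕ) (θ : ℝ) => F j θ * Complex.exp (s * Complex.exp (θ * Complex.I)))
    (fun j => ?_) ?_
  · have h2 : ∀ j, ∫ θ in Set.Ioc 0 (2 * Real.pi),
        F j θ * Complex.exp (s * Complex.exp (θ * Complex.I)) = b j * s ^ j := by
      intro j
      simp only [hF, mul_assoc]
      simp only [integral_const_mul]
      rw [integral_exp_mul_exp_exp]
      have : (j.factorial : ℂ) ≠ 0 := mod_cast j.factorial_ne_zero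
      field_simp
    simp_rw [h2] at h1
    rw [ha.unique h1]
    refine integral_congr_ae (Eventually.of_forall fun θ => ?_)
    exact tsum_mul_right
  · exact (Continuous.integrableOn_Ioc (by fun_prop))
  · refine Summable.of_nonneg_of_le (fun m => integral_nonneg fun θ => norm_nonneg _) (fun j => ?_)
      ((hFs.mul_right (Real.exp |s|)).mul_left
        ((volume.restrict (Set.Ioc 0 (2 * Real.pi))).real Set.univ))
    refine (integral_mono_of_nonneg (Eventually.of_forall fun θ => norm_nonneg _)
      (integrable_const (‖(2 * Real.pi : ℂ)⁻¹‖ * (‖b j‖ * j.factorial) * Real.exp |s|))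
      (Eventually.of_forall fun θ => ?_)).trans_eq ?_
    · simp only
      rw [norm_mul, hFn]
      gcongr
      exact norm_exp_exp_le s θ
    · rw [integral_const, smul_eq_mul]

/-! ## Spherical means of band-limited functions -/

/-- Since `j! j!` divides `(2j)!`, the factorials of the cosine series outweigh the factor `j!`
required for a superposition. -/
lemma factorial_div_factorial_two_mul_le (j : ℕ) :
    (j.factorial : ℝ) / (2 * j).factorial ≤ 1 / j.factorial := by
  rw [div_le_div_iff₀ (by positivity) (by positivity), one_mul]
  have := Nat.le_of_dvd (Nat.factorial_pos _) (Nat.factorial_mul_factorial_dvd_factorial_add j j)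
  rw [two_mul]
  exact_mod_cast this

section

variable {k : ℕ} [NeZero k]

/-- Averaging over `y ↦ -y` replaces the character by a cosine. Being even in `√s`, the cosine
expands in integral powers of `s`. -/
lemma sphereMean_fourierInv (χ : 𝓢(Eucl k, ℂ)) (s : ℝ) :
    sphereMean k (𝓕⁻ χ : 𝓢(Eucl k, ℂ)) s = ∫ p : Metric.sphere (0 : Eucl k) 1 × Eucl k,
      χ p.2 * (Real.cos (√s * (2 * Real.pi * ⟪p.2, (p.1 : Eucl k)⟫)) : ℝ)
        ∂(sphereProb k).prod volume := by
  have hint : ∀ y : Eucl k, Integrable fun v =>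
      Complex.exp ((2 * Real.pi * ⟪v, y⟫ : ℝ) * Complex.I) • χ v := fun y => by
    refine (χ.integrable (μ := volume)).mono (Continuous.aestronglyMeasurable (by fun_prop))
      (Eventually.of_forall fun v => ?_)
    rw [norm_smul, Complex.norm_exp_ofReal_mul_I, one_mul]
  have h1 : sphereMean k (𝓕⁻ χ : 𝓢(Eucl k, ℂ)) s
      = sphereMean k (fun y => ((𝓕⁻ χ : 𝓢(Eucl k, ℂ)) y + (𝓕⁻ χ : 𝓢(Eucl k, ℂ)) (-y)) / 2) s := by
    have h2 := sphereMean_comp_isometry (LinearIsometryEquiv.neg ℝ)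
      ((𝓕⁻ χ : 𝓢(Eucl k, ℂ)) : Eucl k → ℂ) s
    have h3 : sphereMean k (fun y => ((𝓕⁻ χ : 𝓢(Eucl k, ℂ)) y + (𝓕⁻ χ : 𝓢(Eucl k, ℂ)) (-y)) / 2) s
        = (sphereMean k (𝓕⁻ χ : 𝓢(Eucl k, ℂ)) s +
          sphereMean k (fun y => (𝓕⁻ χ : 𝓢(Eucl k, ℂ)) (-y)) s) / 2 := by
      simp only [sphereMean]
      rw [integral_div, integral_add (integrable_sphereProb (by fun_prop))
        (integrable_sphereProb (by fun_prop))]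
    simp only [LinearIsometryEquiv.coe_neg] at h2
    rw [h3, h2]
    ring
  have h4 : ∀ y : Eucl k, ((𝓕⁻ χ : 𝓢(Eucl k, ℂ)) y + (𝓕⁻ χ : 𝓢(Eucl k, ℂ)) (-y)) / 2
      = ∫ v, χ v * (Real.cos (2 * Real.pi * ⟪v, y⟫) : ℝ) := by
    intro y
    rw [SchwartzMap.fourierInv_coe, Real.fourierInv_eq', Real.fourierInv_eq',
      ← integral_add (hint y) (hint (-y)), ← integral_div]
    refine integral_congr_ae (Eventually.of_forall fun v => ?_)
    simp only [smul_eq_mul]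
    rw [Complex.ofReal_cos, Complex.cos, inner_neg_right]
    push_cast
    ring_nf
  rw [h1]
  simp only [h4]
  rw [integral_prod]
  · refine integral_congr_ae (Eventually.of_forall fun u => ?_)
    refine integral_congr_ae (Eventually.of_forall fun v => ?_)
    simp only
    rw [inner_smul_right]
    congr 3
    ring
  · refine ((χ.integrable (μ := volume)).comp_snd (sphereProb k)).mono
      (Continuous.aestronglyMeasurable (by fun_prop)) (Eventually.of_forall fun p => ?_)
    rw [norm_mul, Complex.norm_real]
    exact mul_le_of_le_one_right (norm_nonneg _) (Real.abs_cos_le_one _)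

/-- Expand `cos(√s a) = ∑ (-1)^j a^{2j} s^j / (2j)!`. If `χ` is supported in the ball of radius `R`,
then `|a| ≤ 2πR` there, whence `|b_j| ≤ C (2πR)^{2j} / (2j)!`. -/
lemma exists_hasSum_sphereMean_fourierInv {χ : 𝓢(Eucl k, ℂ)} (hχ : HasCompactSupport χ) :
    ∃ b : ℕ → ℂ, (Summable fun j => ‖b j‖ * j.factorial) ∧ ∀ s : ℝ, 0 ≤ s →
      HasSum (fun j => b j * s ^ j) (sphereMean k (𝓕⁻ χ : 𝓢(Eucl k, ℂ)) s) := by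
  obtain ⟨R, hR0, hR⟩ : ∃ R : ℝ, 0 < R ∧ ∀ x, χ x ≠ 0 → ‖x‖ ≤ R := by
    obtain ⟨R, hR0, hR⟩ := hχ.isCompact.isBounded.exists_pos_norm_le
    exact ⟨R, hR0, fun x hx => hR x (subset_tsupport _ hx)⟩
  set A : ℝ := (2 * Real.pi * R) ^ 2
  let a : Metric.sphere (0 : Eucl k) 1 × Eucl k → ℝ := fun p =>
    2 * Real.pi * ⟪p.2, (p.1 : Eucl k)⟫
  have ha : ∀ p, χ p.2 ≠ 0 → a p ^ 2 ≤ A := fun p hp => by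
    have h1 : |⟪p.2, (p.1 : Eucl k)⟫| ≤ R := by
      refine (abs_real_inner_le_norm _ _).trans ?_
      rw [norm_eq_of_mem_sphere, mul_one]
      exact hR _ hp
    change (2 * Real.pi * ⟪p.2, (p.1 : Eucl k)⟫) ^ 2 ≤ (2 * Real.pi * R) ^ 2
    rw [mul_pow, mul_pow _ R, ← sq_abs ⟪p.2, (p.1 : Eucl k)⟫]
    gcongr
  let G : ℕ → Metric.sphere (0 : Eucl k) 1 × Eucl k → ℂ := fun j p =>
    χ p.2 * (((-1) ^ j * a p ^ (2 * j) / (2 * j).factorial : ℝ) : ℂ)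
  have hGc : ∀ j, Continuous (G j) := fun j => by fun_prop
  have hGb : ∀ j p, ‖G j p‖ ≤ ‖χ p.2‖ * (A ^ j / (2 * j).factorial) := fun j p => by
    simp only [G]
    by_cases hp : χ p.2 = 0
    · simp [hp]
    · rw [norm_mul, Complex.norm_real, norm_div, norm_mul, norm_pow, norm_neg, norm_one, one_pow,
        one_mul, pow_mul, norm_pow, Real.norm_of_nonneg (sq_nonneg _), Real.norm_natCast]
      have := ha p hp
      gcongr
  have hχi : Integrable (fun p : Metric.sphere (0 : Eucl k) 1 × Eucl k => ‖χ p.2‖)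
      ((sphereProb k).prod volume) := ((χ.integrable (μ := volume)).comp_snd (sphereProb k)).norm
  have hGi : ∀ j, Integrable (G j) ((sphereProb k).prod volume) := fun j =>
    (hχi.mul_const _).mono' (hGc j).aestronglyMeasurable (Eventually.of_forall (hGb j))
  set C : ℝ := ∫ p : Metric.sphere (0 : Eucl k) 1 × Eucl k, ‖χ p.2‖ ∂(sphereProb k).prod volume
  have hGn : ∀ j, ∫ p, ‖G j p‖ ∂(sphereProb k).prod volume ≤ C * (A ^ j / (2 * j).factorial) :=
    fun j => (integral_mono (hGi j).norm (hχi.mul_const _) (hGb j)).trans_eq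
      (integral_mul_const _ _)
  have hC : 0 ≤ C := integral_nonneg fun _ => norm_nonneg _
  -- This majorant serves twice: `s = 1` gives the weighted summability of `b`, and general `s`
  -- justifies integrating the cosine series, where `j!` is mere slack.
  have hsum : ∀ s : ℝ, 0 ≤ s → Summable fun j : ℕ => C * (A ^ j / (2 * j).factorial) *
      (j.factorial * s ^ j) := fun s hs => by
    refine Summable.of_nonneg_of_le (fun j => by positivity) (fun j => ?_)
      ((Real.summable_pow_div_factorial (A * s)).mul_left C)
    calc _ = C * (A * s) ^ j * ((j.factorial : ℝ) / (2 * j).factorial) := by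
          rw [mul_pow]
          ring
      _ ≤ C * (A * s) ^ j * (1 / j.factorial) := by
          exact mul_le_mul_of_nonneg_left (factorial_div_factorial_two_mul_le j) (by positivity)
      _ = _ := by ring
  refine ⟨fun j => ∫ p, G j p ∂(sphereProb k).prod volume, ?_, fun s hs => ?_⟩
  · refine Summable.of_nonneg_of_le (fun j => by positivity) (fun j => ?_) (hsum 1 zero_le_one)
    rw [one_pow, mul_one]
    gcongr
    exact (norm_integral_le_integral_norm _).trans (hGn j)
  · rw [sphereMean_fourierInv χ s]
    have h1 := hasSum_integral_of_summable_integral_norm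
      (F := fun j p => G j p * (s : ℂ) ^ j) (fun j => (hGi j).mul_const _) ?_
    · simp_rw [integral_mul_const] at h1
      have h2 : ∀ p : Metric.sphere (0 : Eucl k) 1 × Eucl k, ∑' j, G j p * (s : ℂ) ^ j
          = χ p.2 * (Real.cos (√s * (2 * Real.pi * ⟪p.2, (p.1 : Eucl k)⟫)) : ℝ) := fun p => by
        refine HasSum.tsum_eq ?_
        have h3 := (Complex.hasSum_ofReal.2 (Real.hasSum_cos (√s * a p))).mul_left (χ p.2)
        have h4 : (fun j => G j p * (s : ℂ) ^ j) = fun j : ℕ => χ p.2 *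
            (((-1) ^ j * (√s * a p) ^ (2 * j) / (2 * j).factorial : ℝ) : ℂ) := by
          funext j
          simp only [G]
          rw [mul_assoc, ← Complex.ofReal_pow, ← Complex.ofReal_mul]
          congr 2
          rw [mul_pow √s, pow_mul √s, Real.sq_sqrt hs]
          ring
        rw [h4]
        exact h3
      simp_rw [h2] at h1
      exact h1
    · simp only [norm_mul, norm_pow, Complex.norm_real, Real.norm_of_nonneg hs]
      simp_rw [integral_mul_const]
      refine Summable.of_nonneg_of_le (fun j => mul_nonneg (integral_nonneg fun _ => norm_nonneg _)
        (by positivity)) (fun j => ?_) (hsum s hs)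
      refine mul_le_mul (hGn j) ?_ (by positivity) (by positivity)
      exact le_mul_of_one_le_left (by positivity) (mod_cast Nat.one_le_iff_ne_zero.2
        j.factorial_ne_zero)

end

/-! ## The Fourier transform of a spherical series -/

/-- The point `i (1 - e^{iθ}/π)`, for which `e(s τ / 2) = e^{-πs} exp (s e^{iθ})`. -/
def circlePoint (θ : ℝ) : ℍ :=
  ⟨Complex.I * (1 - Complex.exp (θ * Complex.I) / Real.pi), by
    have h1 : (Complex.I * (1 - Complex.exp (θ * Complex.I) / Real.pi)).im
        = 1 - Real.cos θ / Real.pi := by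
      rw [Complex.I_mul_im, Complex.sub_re, Complex.div_ofReal_re, Complex.exp_ofReal_mul_I_re,
        Complex.one_re]
    rw [h1, sub_pos, div_lt_one Real.pi_pos]
    linarith [Real.cos_le_one θ, Real.pi_gt_three]⟩

lemma coe_circlePoint (θ : ℝ) :
    (circlePoint θ : ℂ) = Complex.I * (1 - Complex.exp (θ * Complex.I) / Real.pi) := rfl

lemma continuous_circlePoint : Continuous circlePoint := by
  rw [UpperHalfPlane.isEmbedding_coe.continuous_iff]
  change Continuous fun θ : ℝ => Complex.I * (1 - Complex.exp (θ * Complex.I) / Real.pi)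
  fun_prop

lemma expo_circlePoint (s θ : ℝ) :
    expo s (circlePoint θ)
      = expo s UpperHalfPlane.I * Complex.exp (s * Complex.exp (θ * Complex.I)) := by
  have hpi : (Real.pi : ℂ) ≠ 0 := mod_cast Real.pi_ne_zero
  rw [expo, expo, ← Complex.exp_add, coe_circlePoint, UpperHalfPlane.coe_I]
  congr 1
  field_simp
  rw [Complex.I_sq]
  ring

/-- The circle about `i` of radius `1/π` is compact in the upper half plane; explicit bounds on it
keep both `τ` and `-1/τ` away from the real line. -/
lemma half_le_im_circlePoint (θ : ℝ) : 1 / 2 ≤ (circlePoint θ).im := by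
  have h1 : (circlePoint θ).im = 1 - Real.cos θ / Real.pi := by
    rw [← UpperHalfPlane.coe_im, coe_circlePoint, Complex.I_mul_im, Complex.sub_re,
      Complex.div_ofReal_re, Complex.exp_ofReal_mul_I_re, Complex.one_re]
  have h2 : Real.cos θ / Real.pi ≤ 1 / 2 := by
    rw [div_le_div_iff₀ Real.pi_pos two_pos]
    linarith [Real.cos_le_one θ, Real.pi_gt_three]
  linarith

lemma norm_circlePoint_le (θ : ℝ) : ‖(circlePoint θ : ℂ)‖ ≤ 2 := by
  rw [coe_circlePoint, norm_mul, Complex.norm_I, one_mul]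
  refine (norm_sub_le _ _).trans ?_
  rw [norm_one, norm_div, Complex.norm_exp_ofReal_mul_I, Complex.norm_real,
    Real.norm_of_nonneg Real.pi_pos.le]
  have : 1 / Real.pi ≤ 1 := by
    rw [div_le_one Real.pi_pos]
    linarith [Real.pi_gt_three]
  linarith

lemma im_negInv (τ : ℍ) : (negInv τ).im = τ.im / ‖(τ : ℂ)‖ ^ 2 := by
  rw [← UpperHalfPlane.coe_im, coe_negInv, Complex.neg_im, Complex.inv_im, Complex.normSq_eq_norm_sq,
    neg_div, neg_neg, UpperHalfPlane.coe_im]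

lemma eighth_le_im_negInv_circlePoint (θ : ℝ) : 1 / 8 ≤ (negInv (circlePoint θ)).im := by
  have h0 : 0 < ‖(circlePoint θ : ℂ)‖ := norm_pos_iff.2 (circlePoint θ).ne_zero
  rw [im_negInv, le_div_iff₀ (by positivity)]
  nlinarith [half_le_im_circlePoint θ, norm_circlePoint_le θ]

lemma contDiff_gaussian_inv (k : ℕ) (τ : ℍ) : ContDiff ℝ ∞ fun x => (gaussian k τ x)⁻¹ :=
  ((gaussian k τ).smooth ⊤).inv fun _ => Complex.exp_ne_zero _

/-- A closed set of Schwartz functions that contains all products of a Gaussian with a band-limited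
Schwartz function contains every Schwartz function. -/
lemma mem_of_isClosed_of_gaussian_mul_fourierInv {k : ℕ} {W : Set 𝓢(Eucl k, ℂ)} (hW : IsClosed W)
    (τ : ℍ) (h : ∀ χ : 𝓢(Eucl k, ℂ), HasCompactSupport χ →
      SchwartzMap.smulLeftCLM ℂ (gaussian k τ) (𝓕⁻ χ) ∈ W) (φ : 𝓢(Eucl k, ℂ)) : φ ∈ W := by
  -- Density is used twice: here to drop the support condition on `χ`, and below to reduce `φ` to
  -- compact support.
  have h1 : ∀ χ : 𝓢(Eucl k, ℂ), SchwartzMap.smulLeftCLM ℂ (gaussian k τ) (𝓕⁻ χ) ∈ W := by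
    have hc : Continuous fun χ : 𝓢(Eucl k, ℂ) =>
        SchwartzMap.smulLeftCLM ℂ (gaussian k τ) (𝓕⁻ χ) :=
      (ContinuousLinearMap.continuous _).comp
        (FourierTransform.fourierInvCLM ℂ 𝓢(Eucl k, ℂ)).continuous
    have := (hW.preimage hc).closure_subset_iff.2 (fun χ hχ => h χ hχ)
    exact fun χ => this (dense_hasCompactSupport χ)
  refine (hW.closure_subset_iff.2 fun ψ hψ => ?_) (dense_hasCompactSupport φ)
  have hψ' : HasCompactSupport ψ := hψ
  -- The reciprocal Gaussian grows, but compact support of `ψ` keeps the quotient Schwartz; it is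
  -- then the inverse transform of `𝓕 χ`.
  let χ : 𝓢(Eucl k, ℂ) := HasCompactSupport.toSchwartzMap
    (f := fun x => (gaussian k τ x)⁻¹ * ψ x) hψ'.mul_left
    ((contDiff_gaussian_inv k τ).mul (ψ.smooth ⊤))
  have h2 : SchwartzMap.smulLeftCLM ℂ (gaussian k τ) χ = ψ := by
    ext x
    rw [SchwartzMap.smulLeftCLM_apply_apply (gaussian k τ).hasTemperateGrowth]
    exact mul_inv_cancel_left₀ (Complex.exp_ne_zero _) _
  have h3 := h1 (𝓕 χ)
  rw [FourierTransform.fourierInv_fourier_eq, h2] at h3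
  exact h3

/-- If `f = ∑ c_m e(lam_m τ / 2)` and `f̃ = ∑ c'_m e(lam'_m τ / 2)`, then the Fourier transform of
`∑ c_m δ_{S_{lam_m}} / vol(S_{lam_m})` is `∑ c'_m δ_{S_{lam'_m}} / vol(S_{lam'_m})`. -/
theorem fourier_spherical_series {k : ℕ} [NeZero k] {lam lam' : ℕ → ℝ} {c c' : ℕ → ℂ}
    (h : IsAdmissible lam c) (h' : IsAdmissible lam' c') {f : ℍ → ℂ}
    (hf : ∀ τ, HasSum (fun m => c m * expo (lam m) τ) (f τ))
    (hf' : ∀ τ, HasSum (fun m => c' m * expo (lam' m) τ) (tilde k f τ))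
    {μ ν : 𝓢'(Eucl k, ℂ)}
    (hμ : ∀ φ : 𝓢(Eucl k, ℂ), HasSum (fun m => c m * sphereMean k φ (lam m)) (μ φ))
    (hν : ∀ φ : 𝓢(Eucl k, ℂ), HasSum (fun m => c' m * sphereMean k φ (lam' m)) (ν φ)) :
    𝓕 μ = ν := by
  have hc : ∀ T : 𝓢'(Eucl k, ℂ), Continuous fun φ => T φ := fun T => map_continuous T
  refine ContinuousLinearMap.ext fun φ => ?_
  have hW : IsClosed {φ : 𝓢(Eucl k, ℂ) | (𝓕 μ) φ = ν φ} := isClosed_eq (hc (𝓕 μ)) (hc ν)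
  refine mem_of_isClosed_of_gaussian_mul_fourierInv hW UpperHalfPlane.I (fun χ hχ => ?_) φ
  obtain ⟨b, hb, hbs⟩ := exists_hasSum_sphereMean_fourierInv hχ
  obtain ⟨β, hβ, ⟨B, hB⟩, hβs⟩ := exists_superposition hb
  -- The height `1/8` bounds from below the imaginary parts of both the circle points and their
  -- images under `τ ↦ -1/τ`.
  let τ₀ : ℍ := ⟨((1 / 8 : ℝ) : ℂ) * Complex.I, by simp⟩
  have hτ₀ : τ₀.im = 1 / 8 := by
    rw [← UpperHalfPlane.coe_im]
    change (((1 / 8 : ℝ) : ℂ) * Complex.I).im = _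
    simp
  refine fourier_apply_eq_of_superposition h h' hf hf' hμ hν _
    (ρ := volume.restrict (Set.Ioc 0 (2 * Real.pi))) hβ hB continuous_circlePoint (τ₀ := τ₀)
    (fun θ => ?_) (fun θ => ?_) fun s hs => ?_
  · rw [hτ₀]
    linarith [half_le_im_circlePoint θ]
  · rw [hτ₀]
    exact eighth_le_im_negInv_circlePoint θ
  -- On each sphere the Gaussian is a constant, which `expo_circlePoint` combines with `exp(s
  -- e^{iθ})` into one exponential.
  · rw [sphereMean_congr hs (g := fun x => expo s UpperHalfPlane.I * (𝓕⁻ χ : 𝓢(Eucl k, ℂ)) x)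
      fun x hx => ?_]
    · have h1 : sphereMean k (fun x => expo s UpperHalfPlane.I * (𝓕⁻ χ : 𝓢(Eucl k, ℂ)) x) s
          = expo s UpperHalfPlane.I * sphereMean k (𝓕⁻ χ : 𝓢(Eucl k, ℂ)) s :=
        integral_const_mul _ _
      rw [h1, hβs s _ (hbs s hs), ← integral_const_mul]
      refine integral_congr_ae (Eventually.of_forall fun θ => ?_)
      simp only
      rw [expo_circlePoint, mul_left_comm]
    · rw [SchwartzMap.smulLeftCLM_apply_apply (gaussian k _).hasTemperateGrowth, gaussian_apply, hx,
        smul_eq_mul]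

/-! ## The isomorphism -/

section

variable {k : ℕ} [NeZero k]

lemma IsAdmissible.theta_eq {lam : ℕ → ℝ} {c : ℕ → ℂ} (h : IsAdmissible lam c) {f : ℍ → ℂ}
    (hf : ∀ τ, HasSum (fun m => c m * expo (lam m) τ) (f τ)) {μ : 𝓢'(Eucl k, ℂ)}
    (hμ : ∀ φ : 𝓢(Eucl k, ℂ), HasSum (fun m => c m * sphereMean k φ (lam m)) (μ φ)) :
    theta μ = f := by
  funext τ
  have := hμ (gaussian k τ)
  simp only [sphereMean_gaussian τ (h.nonneg _)] at this
  exact this.unique (hf τ)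

lemma exists_mem_Meas_theta_eq {f : ℍ → ℂ} (hf : f ∈ FS k) : ∃ μ ∈ Meas k, theta μ = f := by
  obtain ⟨⟨-, lam, c, hadm, hs⟩, lam', c', hadm', hs'⟩ := hf
  rw [hasSum_seriesSpace_expo_iff] at hs hs'
  obtain ⟨μ, hμ⟩ := hadm.exists_hasSum_sphereMean (k := k)
  obtain ⟨ν, hν⟩ := hadm'.exists_hasSum_sphereMean (k := k)
  refine ⟨μ, ⟨⟨lam, _, hadm.div_sphereVol, hadm.hasSum_div_sphereVol hμ⟩, ?_⟩,
    hadm.theta_eq hs hμ⟩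
  change 𝓕 μ ∈ seriesSpace (sphereDist k)
  rw [fourier_spherical_series hadm hadm' hs hs' hμ hν]
  exact ⟨lam', _, hadm'.div_sphereVol, hadm'.hasSum_div_sphereVol hν⟩

variable (k) in
/-- The theta map as an isomorphism from spherical measures to Fourier series. -/
def thetaEquiv : Meas k ≃ₗ[ℂ] FS k :=
  LinearEquiv.ofBijective ((thetaLin k).restrict fun _ hμ => theta_mem_FS hμ) <| by
    refine ⟨fun μ ν h => ?_, fun f => ?_⟩
    · exact Subtype.ext (theta_injOn μ.2.1 ν.2.1 (congrArg Subtype.val h))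
    · obtain ⟨μ, hμ, h⟩ := exists_mem_Meas_theta_eq f.2
      exact ⟨⟨μ, hμ⟩, Subtype.ext h⟩

lemma coe_thetaEquiv (μ : Meas k) :
    (thetaEquiv k μ : ℍ → ℂ) = theta (μ : 𝓢'(Eucl k, ℂ)) := rfl

/-- Any admissible expansion of `f` sums to a spherical series with theta function `f`, and
`theta_injOn` identifies it with the preimage. The choice of expansion is therefore immaterial. -/
lemma hasSum_thetaEquiv_symm (f : FS k) {lam : ℕ → ℝ} {c : ℕ → ℂ} (h : IsAdmissible lam c)
    (hf : ∀ τ, HasSum (fun m => c m * expo (lam m) τ) ((f : ℍ → ℂ) τ)) :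
    HasSum (fun m => (c m / (sphereVol k (lam m) : ℂ)) • sphereDist k (lam m))
      ((thetaEquiv k).symm f : 𝓢'(Eucl k, ℂ)) := by
  obtain ⟨μ, hμ⟩ := h.exists_hasSum_sphereMean (k := k)
  have hs := h.hasSum_div_sphereVol hμ
  convert hs
  refine theta_injOn ((thetaEquiv k).symm f).2.1 ⟨lam, _, h.div_sphereVol, hs⟩ ?_
  rw [← coe_thetaEquiv, LinearEquiv.apply_symm_apply, h.theta_eq hf hμ]

end

end SphericalMeasure

end

theorem mainTheorem1 (k : ℕ) (hk : 0 < k) :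
    (∃ Θ : SphericalMeasure.Meas k ≃ₗ[ℂ] SphericalMeasure.FS k,
      (∀ μ : SphericalMeasure.Meas k,
        (Θ μ : ℍ → ℂ) = SphericalMeasure.theta (μ : 𝓢'(SphericalMeasure.Eucl k, ℂ))) ∧
      (∀ (f : SphericalMeasure.FS k) (lam : ℕ → ℝ) (c : ℕ → ℂ),
        SphericalMeasure.IsAdmissible lam c →
        (∀ τ : ℍ, HasSum (fun m => c m * SphericalMeasure.expo (lam m) τ) ((f : ℍ → ℂ) τ)) →
        HasSum
          (fun m => (c m / (SphericalMeasure.sphereVol k (lam m) : ℂ)) •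
            SphericalMeasure.sphereDist k (lam m))
          (Θ.symm f : 𝓢'(SphericalMeasure.Eucl k, ℂ)))) ∧
    (∀ (μ : 𝓢'(SphericalMeasure.Eucl k, ℂ)) (M : SphericalMeasure.Mp2),
      SphericalMeasure.theta (SphericalMeasure.distSlash μ M) =
        SphericalMeasure.slash k (SphericalMeasure.theta μ) M) ∧
    (∀ μ ∈ SphericalMeasure.Meas k,
      𝓕 μ = μ ↔ ∀ τ : ℍ, SphericalMeasure.theta μ (SphericalMeasure.negInv τ) =
        SphericalMeasure.sqrtNegI τ ^ k * SphericalMeasure.theta μ τ) := by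
  -- In positive dimension the unit sphere has positive area, so `sphereProb k` is a probability
  -- measure.
  have : NeZero k := ⟨hk.ne'⟩
  exact ⟨⟨SphericalMeasure.thetaEquiv k, SphericalMeasure.coe_thetaEquiv,
    fun f lam c h hf => SphericalMeasure.hasSum_thetaEquiv_symm f h hf⟩,
    SphericalMeasure.theta_distSlash, fun μ hμ => SphericalMeasure.fourier_eq_self_iff hμ⟩
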